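/- Let $(M,\sigma_M)$ be a closed symplectic manifold (compact, without boundary, smooth) of positive dimension, and let $T^2=\mathbb{R}^2/(2\pi\mathbb{Z})^2$ be the torus with coordinates $x,y$ modulo $2\pi$ and symplectic form $\sigma_T=dx\wedge dy$. A finite family $X=(X_1,\dots,X_N)$ of smooth vector fields on a manifold is called a singular distribution if there is $A\in\mathbb{N}$ such that $\mathcal{L}|_p=\mathrm{span}(X_1(p),\dots,X_N(p))$ has dimension $A$ for almost every point $p$; we then say it has rank $A$. It is isotropic for a $2$-form $\sigma$ if $\sigma$ vanishes on $\mathcal{L}|_p$ for every $p$. It satisfies Hörmander's condition if for some $r$ the iterated commutators $[X_{k_1},[X_{k_2},\dots,[X_{k_{s-1}},X_{k_s}]\dots]]$ of lengths $s\le r$ span the tangent space at every point. Then there exists on $(T^2\times M,\sigma_T\oplus\sigma_M)$ an isotropic singular distribution which satisfies Hörmander's condition. More precisely, there exist a Morse function on $M$ and, for some $d$, smooth vector fields $Z_1,\dots,Z_{2d}$ on $M$ that span $T_zM$ for every $z\in M$; and for every Morse function $h$ on $M$ and all such $d$ and $Z_1,\dots,Z_{2d}$, the two vector fields on $T^2\times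 M$ $$V(x,y,z)=\frac{\partial}{\partial x}+h(z)\frac{\partial}{\partial y},\qquad W(x,y,z)=\sum_{l=1}^{2d}\phi_l(x)Z_l(z),\qquad \phi_{2j-1}(x)=\sin(jx),\ \ \phi_{2j}(x)=\cos(jx)\quad(1\le j\le d),$$ form an isotropic singular distribution of rank $2$ which satisfies Hörmander's condition, and the zero set of $W$ is closed and of measure zero. -/

import Mathlib

open MeasureTheory Set
open scoped Manifold ContDiff Topology

noncomputable section

section General

variable {E : Type*} [NormedAddCommGroup E] [NormedSpace ℝ E]
  {H : Type*} [TopologicalSpace H]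

/-- A (not necessarily smooth) vector field on the manifold `M` modelled on `I`. -/
abbrev VField (I : ModelWithCorners ℝ E H) (M : Type*) [TopologicalSpace M]
    [ChartedSpace H M] : Type _ :=
  (x : M) → TangentSpace I x

/-- A (not necessarily smooth) differential 2-form on the manifold `M` modelled on `I`. -/
abbrev TwoForm (I : ModelWithCorners ℝ E H) (M : Type*) [TopologicalSpace M]
    [ChartedSpace H M] : Type _ :=
  (x : M) → (TangentSpace I x) [⋀^Fin 2]→L[ℝ] ℝ

variable {I : ModelWithCorners ℝ E H} {M : Type*} [TopologicalSpace M] [ChartedSpace H M]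

/-- Smoothness (of class `C^∞`) of a vector field, as a section of the tangent bundle. -/
def SmoothVField [IsManifold I ∞ M] (V : VField I M) : Prop :=
  ContMDiff I I.tangent ∞ (fun x => (⟨x, V x⟩ : TangentBundle I M))

/-! ### Symplectic forms -/

/-- The expression of the 2-form `η` in the chart of `M` around `c`: the pull-back of `η` under
the inverse of the chart, a differential form on (an open subset of) the model space. -/
def TwoForm.inChart (η : TwoForm I M) (c : M) : E → E [⋀^Fin 2]→L[ℝ] ℝ := fun y =>
  (η ((extChartAt I c).symm y)).compContinuousLinearMap
    (mfderiv 𝓘(ℝ, E) I (extChartAt I c).symm y)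

/-- A symplectic form on a manifold without boundary: a 2-form that is smooth, closed (both
expressed in charts) and nondegenerate at every point. -/
structure IsSymplecticForm [I.Boundaryless] (η : TwoForm I M) : Prop where
  smooth : ∀ c : M, ContDiffOn ℝ ∞ (η.inChart c) (extChartAt I c).target
  closed : ∀ c : M, ∀ y ∈ (extChartAt I c).target, extDeriv (η.inChart c) y = 0
  nondegenerate : ∀ (x : M) (u : TangentSpace I x),
    (∀ v : TangentSpace I x, η x ![u, v] = 0) → u = 0

/-- The direct sum `η₁ ⊕ η₂ = pr₁^* η₁ + pr₂^* η₂` on a product manifold. (The tangent space of a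
product at `p` is the product of the tangent spaces, and the two projections of tangent vectors
are the differentials of the projections of the product.) -/
def TwoForm.directSum {E' : Type*} [NormedAddCommGroup E'] [NormedSpace ℝ E']
    {H' : Type*} [TopologicalSpace H'] {I' : ModelWithCorners ℝ E' H'}
    {M' : Type*} [TopologicalSpace M'] [ChartedSpace H' M']
    (η₁ : TwoForm I M) (η₂ : TwoForm I' M') : TwoForm (I.prod I') (M × M') := fun p =>
  (η₁ p.1).compContinuousLinearMap
      (ContinuousLinearMap.fst ℝ (TangentSpace I p.1) (TangentSpace I' p.2)) +
    (η₂ p.2).compContinuousLinearMap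
      (ContinuousLinearMap.snd ℝ (TangentSpace I p.1) (TangentSpace I' p.2))

/-! ### Null sets and Morse functions -/

/-- A set of measure zero in a manifold: its image in every chart has Lebesgue measure zero.
(Lebesgue measure on the model space is only defined up to a factor, which is irrelevant here: it is
an additive Haar measure.) -/
def IsNullSet [FiniteDimensional ℝ E] [MeasurableSpace E] [BorelSpace E]
    (I : ModelWithCorners ℝ E H) {M : Type*} [TopologicalSpace M] [ChartedSpace H M]
    (s : Set M) : Prop :=
  ∀ c : M, (Measure.addHaar : Measure E) (extChartAt I c '' (s ∩ (extChartAt I c).source)) = 0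

/-- A Morse function on a manifold without boundary: a smooth real function whose Hessian (in the
chart around the point) is nondegenerate at every critical point. -/
structure IsMorseFunction (I : ModelWithCorners ℝ E H) [I.Boundaryless] {M : Type*}
    [TopologicalSpace M] [ChartedSpace H M] (h : M → ℝ) : Prop where
  smooth : ContMDiff I 𝓘(ℝ, ℝ) ∞ h
  nondegenerate : ∀ x : M, mfderiv I 𝓘(ℝ, ℝ) h x = 0 →
    ∀ u : E, (∀ v : E, fderiv ℝ (fderiv ℝ (h ∘ (extChartAt I x).symm)) (extChartAt I x x) u v = 0) →
      u = 0

/-! ### Singular distributions and Hörmander's condition -/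

/-- The linear span `𝓛|ₓ` of the vectors `X₁(x), …, X_N(x)` in the tangent space at `x`. -/
def spanAt {N : ℕ} (X : Fin N → VField I M) (x : M) : Submodule ℝ (TangentSpace I x) :=
  Submodule.span ℝ (range fun k => X k x)

/-- A singular distribution of rank `A`: finitely many smooth vector fields whose span has
dimension `A` almost everywhere. -/
structure IsSingularDistributionOfRank [IsManifold I ∞ M]
    [FiniteDimensional ℝ E] [MeasurableSpace E] [BorelSpace E]
    {N : ℕ} (X : Fin N → VField I M) (A : ℕ) : Prop where
  smooth : ∀ k, SmoothVField (X k)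
  rank : IsNullSet I {x : M | Module.finrank ℝ (spanAt X x) ≠ A}

/-- A singular distribution: a singular distribution of some rank. -/
def IsSingularDistribution [IsManifold I ∞ M]
    [FiniteDimensional ℝ E] [MeasurableSpace E] [BorelSpace E]
    {N : ℕ} (X : Fin N → VField I M) : Prop :=
  ∃ A : ℕ, IsSingularDistributionOfRank X A

/-- The distribution spanned by `X` is isotropic for `η`: the form `η` vanishes on `𝓛|ₓ` for
every `x`. -/
def IsIsotropic (η : TwoForm I M) {N : ℕ} (X : Fin N → VField I M) : Prop :=
  ∀ x : M, ∀ u ∈ spanAt X x, ∀ v ∈ spanAt X x, η x ![u, v] = 0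

/-- `IsIteratedCommutator X s Y` says that `Y` is an iterated commutator
`[X_{k₁}, [X_{k₂}, … [X_{k_{s-1}}, X_{k_s}] … ]]` of length `s` of the vector fields `X`. -/
inductive IsIteratedCommutator {N : ℕ} (X : Fin N → VField I M) : ℕ → VField I M → Prop
  | single (k : Fin N) : IsIteratedCommutator X 1 (X k)
  | bracket (k : Fin N) (s : ℕ) (Y : VField I M) (hY : IsIteratedCommutator X s Y) :
      IsIteratedCommutator X (s + 1) (VectorField.mlieBracket I (X k) Y)

/-- The `r`-Hörmander condition: the iterated commutators of the `X k` of lengths at most `r` span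
the tangent space at every point. -/
def HormanderCondition {N : ℕ} (X : Fin N → VField I M) (r : ℕ) : Prop :=
  ∀ x : M, Submodule.span ℝ
    {u : TangentSpace I x | ∃ s ≤ r, ∃ Y : VField I M, IsIteratedCommutator X s Y ∧ Y x = u} = ⊤

/-- Hörmander's condition: the `r`-Hörmander condition for some `r`. -/
def SatisfiesHormander {N : ℕ} (X : Fin N → VField I M) : Prop :=
  ∃ r : ℕ, HormanderCondition X r

end General

/-! ### The torus `T² = S¹ × S¹`, with coordinates `(e^{ix}, e^{iy})` -/

/-- The coordinate vector field `∂/∂t` on the circle with coordinate `e^{it}`, `t` modulo `2π`: the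
velocity at `t = 0` of the curve `t ↦ z e^{it}`. -/
def circleD (z : Circle) : TangentSpace (𝓡 1) z :=
  mfderiv 𝓘(ℝ, ℝ) (𝓡 1) (fun t : ℝ => z * Circle.exp t) 0 (1 : ℝ)

/-- The coordinate 1-form `dt = Im (z̄ dz)` on the circle with coordinate `z = e^{it}`. -/
def circleForm (z : Circle) : TangentSpace (𝓡 1) z →L[ℝ] ℝ :=
  (Complex.imCLM.comp (ContinuousLinearMap.mul ℝ ℂ (starRingEnd ℂ (z : ℂ)))).comp
    (mfderiv (𝓡 1) 𝓘(ℝ, ℂ) (fun w : Circle => (w : ℂ)) z)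

/-- The determinant, as a continuous alternating form on `ℝ²`: `(a, b) ↦ a₀ b₁ - a₁ b₀`. -/
def detForm : (Fin 2 → ℝ) [⋀^Fin 2]→L[ℝ] ℝ :=
  { (Matrix.detRowAlternating : (Fin 2 → ℝ) [⋀^Fin 2]→ₗ[ℝ] ℝ) with
    cont := by
      change Continuous fun A : Matrix (Fin 2) (Fin 2) ℝ => A.det
      exact Continuous.matrix_det continuous_id }

/-- The standard symplectic form `σ_T = dx ∧ dy` of the torus `T²`. -/
def torusForm : TwoForm ((𝓡 1).prod (𝓡 1)) (Circle × Circle) := fun p =>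
  detForm.compContinuousLinearMap
    (ContinuousLinearMap.pi ![
      (circleForm p.1).comp
        (ContinuousLinearMap.fst ℝ (TangentSpace (𝓡 1) p.1) (TangentSpace (𝓡 1) p.2)),
      (circleForm p.2).comp
        (ContinuousLinearMap.snd ℝ (TangentSpace (𝓡 1) p.1) (TangentSpace (𝓡 1) p.2))])

/-- The trigonometric functions `sin x, cos x, sin 2x, cos 2x, …` as functions on the circle, at
the point `z = e^{ix}`; the index starts from `0`. -/
def trigFun (l : ℕ) (z : Circle) : ℝ :=
  if Even l then ((z : ℂ) ^ (l / 2 + 1)).im else ((z : ℂ) ^ (l / 2 + 1)).re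

theorem trigFun_exp_even (j : ℕ) (x : ℝ) :
    trigFun (2 * j) (Circle.exp x) = Real.sin ((j + 1 : ℕ) * x) := by
  have h1 : 2 * j / 2 = j := by omega
  simp only [trigFun, even_two_mul, if_true, Circle.coe_exp, h1, ← Complex.exp_nat_mul]
  rw [← mul_assoc, show ((j + 1 : ℕ) : ℂ) * (x : ℂ) = (((j + 1 : ℕ) * x : ℝ) : ℂ) by push_cast; rfl,
    Complex.exp_ofReal_mul_I_im]

theorem trigFun_exp_odd (j : ℕ) (x : ℝ) :
    trigFun (2 * j + 1) (Circle.exp x) = Real.cos ((j + 1 : ℕ) * x) := by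
  have h1 : (2 * j + 1) / 2 = j := by omega
  have h2 : ¬ Even (2 * j + 1) := by simp
  simp only [trigFun, h2, if_false, Circle.coe_exp, h1, ← Complex.exp_nat_mul]
  rw [← mul_assoc, show ((j + 1 : ℕ) : ℂ) * (x : ℂ) = (((j + 1 : ℕ) * x : ℝ) : ℂ) by push_cast; rfl,
    Complex.exp_ofReal_mul_I_re]

/-! ### The vector fields `V` and `W` on `T² × M` -/

section Fields

variable {n : ℕ} {M : Type*} [TopologicalSpace M] [ChartedSpace (EuclideanSpace ℝ (Fin n)) M]

/-- The model of the manifold `T² × M`, where `M` is a manifold of dimension `n`. -/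
abbrev torusProdModel (n : ℕ) :=
  ((𝓡 1).prod (𝓡 1)).prod (𝓡 n)

/-- The vector field `V = ∂/∂x + h(z) ∂/∂y` on `T² × M`. -/
def fieldV (h : M → ℝ) : VField (torusProdModel n) ((Circle × Circle) × M) := fun p =>
  ((circleD p.1.1, h p.2 • circleD p.1.2), (0 : TangentSpace (𝓡 n) p.2))

/-- The vector field `W = ∑ₗ φₗ(x) Zₗ(z)` on `T² × M`, where the `φₗ` are the first `2 d` of the
functions `sin x, cos x, sin 2x, cos 2x, …`. -/
def fieldW {d : ℕ} (Z : Fin (2 * d) → VField (𝓡 n) M) :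
    VField (torusProdModel n) ((Circle × Circle) × M) := fun p =>
  (((0 : TangentSpace (𝓡 1) p.1.1), (0 : TangentSpace (𝓡 1) p.1.2)),
    ∑ l : Fin (2 * d), trigFun l p.1.1 • Z l p.2)

/-- A finite family of smooth vector fields that spans the tangent space at every point. -/
structure IsSpanningFamily [IsManifold (𝓡 n) ∞ M] {N : ℕ} (Z : Fin N → VField (𝓡 n) M) :
    Prop where
  smooth : ∀ l, SmoothVField (Z l)
  span : ∀ z : M, spanAt Z z = ⊤

end Fields

end

/-! Put A_0 = W and A_{k+1} = [V, A_k]. By induction A_k = Σ φ_l^{(k)} Z_l − k (Σ φ_l^{(k-1)} Z_l h)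
∂/∂y (`mlieBracket_fieldV_iterField`). Suppose that a covector at (x, y, z) kills all commutators up
to a fixed length. The 4d sequences φ_l^{(k)}(x) and k φ_l^{(k-1)}(x), for k < 4d, are linearly
independent: this is a confluent Vandermonde system with the 2d nodes ±i, …, ±id, each doubled
(`eq_zero_of_sum_trigDer_eq_zero`). Evaluating the covector on the A_k, one finds that it kills
every Z_l, hence T_zM, and that it kills ∂/∂y or z is a critical point of h.

At a critical point the ∂/∂y-component of [A_j, A_k] is j H(k, j-1) − k H(j, k-1), where H(j, k) is
the Hessian of h on the M-components of A_j and A_k. If the covector does not kill ∂/∂y, these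
numbers vanish; induction starting from k = 0 gives H(j, k) = 0 in the needed range, and
independence of the derivatives of the φ_l together with the spanning property of the Z_l makes the
Hessian zero, which a Morse function in positive dimension forbids. So ∂/∂y is killed, and V then
gives ∂/∂x (`hormanderCondition_fieldV_fieldW`).

Isotropy holds because V is tangent to the torus and W to M, so each summand of the form only sees
multiples of one vector. The rank is 2 wherever W ≠ 0. For fixed z some coordinate of W is a nonzero
trigonometric polynomial in x, so W has finitely many zeros on each x-circle, and Fubini makes its
zero set null.

Morse functions come from generic combinations of cut-off coordinates: the bad parameters are
critical values of a map between spaces of equal dimension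
(`addHaar_setOf_degenerate_zero_eq_zero`). -/

/-! ### Vector fields in charts, and the bracket as a commutator of derivations. -/

section ChartField

variable {E : Type*} [NormedAddCommGroup E] [NormedSpace ℝ E]
  {H : Type*} [TopologicalSpace H] {I : ModelWithCorners ℝ E H} [I.Boundaryless]
  {M : Type*} [TopologicalSpace M] [ChartedSpace H M]
  {F : Type*} [NormedAddCommGroup F] [NormedSpace ℝ F]

/-- The expression of a vector field in the chart around `x`. -/
noncomputable def chartField (Z : VField I M) (x : M) : E → E :=
  VectorField.mpullbackWithin 𝓘(ℝ, E) I (extChartAt I x).symm Z (range I)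

theorem differentiableAt_chartField [IsManifold I 2 M] [CompleteSpace E] {Z : VField I M} {x : M}
    (hZ : MDifferentiableAt I I.tangent (fun x => (⟨x, Z x⟩ : TangentBundle I M)) x) :
    DifferentiableAt ℝ (chartField Z x) (extChartAt I x x) := by
  have h := MDifferentiableWithinAt.differentiableWithinAt_mpullbackWithin_vectorField
    hZ.mdifferentiableWithinAt (s := univ)
  have h' : DifferentiableWithinAt ℝ (chartField Z x)
    ((extChartAt I x).symm ⁻¹' univ ∩ range I) (extChartAt I x x) := h
  rwa [I.range_eq_univ, preimage_univ, inter_univ, differentiableWithinAt_univ] at h'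

theorem mvfderiv_eq_fderiv_chart {f : M → F} {x : M} (hf : MDifferentiableAt I 𝓘(ℝ, F) f x)
    (v : TangentSpace I x) :
    mvfderiv I f x v = fderiv ℝ (f ∘ (extChartAt I x).symm) (extChartAt I x x) v := by
  rw [hf.mvfderiv, I.range_eq_univ, fderivWithin_univ]
  rfl

variable [IsManifold I 1 M]

omit [I.Boundaryless] in
theorem chartField_self (Z : VField I M) (x : M) : chartField Z x (extChartAt I x x) = Z x := by
  have h := mfderivWithin_extChartAt_symm_inverse_apply (I := I) (x := x) (Z x)
  have e : (extChartAt I x).symm (extChartAt I x x) = x := extChartAt_to_inv x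
  -- The tangent space depends on the base point, and `symm (extChartAt x x) = x` is not
  -- definitional; the point is generalized so that it can be substituted.
  have key : ∀ y, y = x → ∀ L : E →L[ℝ] E, L.inverse (Z x : E) = (Z x : E) →
      L.inverse (Z y : E) = (Z x : E) := by
    rintro y rfl L hL
    exact hL
  exact key _ e _ h

/-- The inverse differential in `chartField` cancels against the chain rule. Holding on the whole
chart domain, the identity can be differentiated once more. -/
theorem mvfderiv_apply_eq_fderiv_chartField {f : M → F} {Z : VField I M} {x z : M}
    (hz : z ∈ (extChartAt I x).source) (hf : MDifferentiableAt I 𝓘(ℝ, F) f z) :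
    mvfderiv I f z (Z z) =
      fderiv ℝ (f ∘ (extChartAt I x).symm) (extChartAt I x z) (chartField Z x (extChartAt I x z)) := by
  obtain ⟨y, hy, rfl⟩ : ∃ y ∈ (extChartAt I x).target, (extChartAt I x).symm y = z :=
    ⟨_, (extChartAt I x).map_source hz, (extChartAt I x).left_inv hz⟩
  rw [(extChartAt I x).right_inv hy]
  have h2 := mdifferentiableWithinAt_extChartAt_symm (I := I) hy
  rw [I.range_eq_univ] at h2
  have h3 := isInvertible_mfderivWithin_extChartAt_symm (I := I) hy
  have hc := mfderiv_comp (I := 𝓘(ℝ, E)) y hf (mdifferentiableWithinAt_univ.1 h2)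
  rw [mfderiv_eq_fderiv] at hc
  obtain ⟨e, he⟩ := h3
  have hcf : chartField Z x y = (mfderivWithin 𝓘(ℝ, E) I (extChartAt I x).symm (range I) y).inverse
    (Z ((extChartAt I x).symm y)) := rfl
  rw [hcf, hc, ← he, ContinuousLinearMap.inverse_equiv]
  rw [I.range_eq_univ, mfderivWithin_univ] at he
  rw [← he]
  exact (congrArg (mvfderiv I f ((extChartAt I x).symm y)) (e.apply_symm_apply _)).symm

theorem mlieBracket_eq_lieBracket_chartField (V W : VField I M) (x : M) :
    VectorField.mlieBracket I V W x =
      VectorField.lieBracket ℝ (chartField V x) (chartField W x) (extChartAt I x x) := by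
  have h := VectorField.mlieBracketWithin_apply (I := I) (V := V) (W := W) (s := univ) (x₀ := x)
  rw [VectorField.mlieBracketWithin_univ, mfderiv_extChartAt_self] at h
  have h1 : ∀ u : E, (ContinuousLinearMap.id ℝ E).inverse u = u := by simp
  refine h.trans ((h1 _).trans ?_)
  have h2 : VectorField.lieBracketWithin ℝ (chartField V x) (chartField W x)
      ((extChartAt I x).symm ⁻¹' univ ∩ range I) (extChartAt I x x) =
      VectorField.lieBracket ℝ (chartField V x) (chartField W x) (extChartAt I x x) := by
    rw [I.range_eq_univ, preimage_univ, inter_univ, VectorField.lieBracketWithin_univ]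
  exact h2

/-- The derivative of the function `Z f`, in the chart around the point. -/
theorem mvfderiv_mvfderiv_apply [IsManifold I 2 M] [CompleteSpace E] {f : M → F} {Z : VField I M}
    {x : M} (hf : ContMDiffAt I 𝓘(ℝ, F) 2 f x)
    (hZ : MDifferentiableAt I I.tangent (fun x => (⟨x, Z x⟩ : TangentBundle I M)) x)
    (v : TangentSpace I x) :
    MDifferentiableAt I 𝓘(ℝ, F) (fun z => mvfderiv I f z (Z z)) x ∧
    mvfderiv I (fun z => mvfderiv I f z (Z z)) x v =
      fderiv ℝ (fderiv ℝ (f ∘ (extChartAt I x).symm)) (extChartAt I x x) v (Z x) +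
      mvfderiv I f x (fderiv ℝ (chartField Z x) (extChartAt I x x) v : E) := by
  have hev : ∀ᶠ z in 𝓝 x, MDifferentiableAt I 𝓘(ℝ, F) f z :=
    ((contMDiffAt_iff_contMDiffAt_nhds (by simp)).1 hf).mono fun z hz => hz.mdifferentiableAt (by simp)
  set φ := extChartAt I x with hφ
  have hC : ContDiffAt ℝ 2 (f ∘ φ.symm) (φ x) := by
    have := (contMDiffAt_iff.1 hf).2
    rw [I.range_eq_univ, contDiffWithinAt_univ] at this
    exact this
  have hD : DifferentiableAt ℝ (fderiv ℝ (f ∘ φ.symm)) (φ x) :=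
    (hC.fderiv_right (m := 1) (by norm_num)).differentiableAt (by simp)
  have hG : DifferentiableAt ℝ
      (fun y => fderiv ℝ (f ∘ φ.symm) y (chartField Z x y)) (φ x) :=
    hD.clm_apply (differentiableAt_chartField hZ)
  have heq : (fun z => mvfderiv I f z (Z z)) =ᶠ[𝓝 x]
      (fun y => fderiv ℝ (f ∘ φ.symm) y (chartField Z x y)) ∘ φ := by
    filter_upwards [hev, extChartAt_source_mem_nhds (I := I) x] with z hz hzs
    exact mvfderiv_apply_eq_fderiv_chartField hzs hz
  have hφd : MDifferentiableAt I 𝓘(ℝ, E) φ x :=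
    mdifferentiableAt_extChartAt (mem_chart_source H x)
  have hm := hG.mdifferentiableAt.comp x hφd
  have hm' : MDifferentiableAt I 𝓘(ℝ, F) (fun z => mvfderiv I f z (Z z)) x :=
    hm.congr_of_eventuallyEq heq
  refine ⟨hm', ?_⟩
  have h1 : mvfderiv I (fun z => mvfderiv I f z (Z z)) x v =
      fderiv ℝ (fun y => fderiv ℝ (f ∘ φ.symm) y (chartField Z x y)) (φ x) v := by
    rw [mvfderiv_eq_fderiv_chart hm']
    congr 1
    apply Filter.EventuallyEq.fderiv_eq
    filter_upwards [(continuousAt_extChartAt_symm (I := I) x).eventually (by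
      rw [extChartAt_to_inv]; exact heq), extChartAt_target_mem_nhds (I := I) x] with y hy hyt
    refine hy.trans ?_
    simp only [Function.comp]
    rw [φ.right_inv hyt]
  have h2 := congrArg (fun L : E →L[ℝ] F => L v)
    (hD.hasFDerivAt.clm_apply (differentiableAt_chartField hZ).hasFDerivAt).fderiv
  have h3 := mvfderiv_eq_fderiv_chart hev.self_of_nhds (fderiv ℝ (chartField Z x) (φ x) v : E)
  have h4 : fderiv ℝ (fderiv ℝ (f ∘ φ.symm)) (φ x) v (Z x) =
    fderiv ℝ (fderiv ℝ (f ∘ φ.symm)) (φ x) v (chartField Z x (φ x)) :=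
    congrArg (fderiv ℝ (fderiv ℝ (f ∘ φ.symm)) (φ x) v) (chartField_self Z x).symm
  refine (h1.trans h2).trans ((add_comm _ _).trans ?_)
  exact congrArg₂ (· + ·) h4.symm h3.symm

/-- The Lie bracket of vector fields is the commutator of the associated derivations. -/
theorem mvfderiv_mlieBracket [IsManifold I 2 M] [CompleteSpace E] {f : M → F} {V W : VField I M}
    {x : M} (hf : ContMDiffAt I 𝓘(ℝ, F) 2 f x)
    (hV : MDifferentiableAt I I.tangent (fun x => (⟨x, V x⟩ : TangentBundle I M)) x)
    (hW : MDifferentiableAt I I.tangent (fun x => (⟨x, W x⟩ : TangentBundle I M)) x) :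
    mvfderiv I f x (VectorField.mlieBracket I V W x) =
      mvfderiv I (fun z => mvfderiv I f z (W z)) x (V x) -
      mvfderiv I (fun z => mvfderiv I f z (V z)) x (W x) := by
  rw [(mvfderiv_mvfderiv_apply hf hV _).2, (mvfderiv_mvfderiv_apply hf hW _).2,
    mlieBracket_eq_lieBracket_chartField, VectorField.lieBracket, chartField_self, chartField_self]
  have hC : ContDiffAt ℝ 2 (f ∘ (extChartAt I x).symm) (extChartAt I x x) := by
    have := (contMDiffAt_iff.1 hf).2
    rw [I.range_eq_univ, contDiffWithinAt_univ] at this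
    exact this
  -- Symmetry of the second derivative cancels the second-order terms; what remains is the
  -- differential of f on the bracket in the chart.
  have hs := (hC.isSymmSndFDerivAt (by simp)).eq (V x) (W x)
  rw [hs]
  have := (mvfderiv I f x).map_sub
    (fderiv ℝ (chartField W x) (extChartAt I x x) (V x) : E)
    (fderiv ℝ (chartField V x) (extChartAt I x x) (W x) : E)
  refine Eq.trans this ?_
  abel

end ChartField

/-! ### Confluent Vandermonde systems. -/

section Confluent

open Polynomial

/-- The functional P ↦ Σ (a P(r) + b P'(r)) is linear, so vanishing on the monomials below degree K
suffices. -/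
theorem sum_eval_add_derivative_eq_zero {S : Type*} [Fintype S] {a b r : S → ℂ} {K : ℕ}
    (h : ∀ k < K, ∑ s, (a s * r s ^ k + b s * (k * r s ^ (k - 1))) = 0)
    {P : ℂ[X]} (hP : P.natDegree < K) :
    ∑ s, (a s * P.eval (r s) + b s * (derivative P).eval (r s)) = 0 := by
  have h1 : ∀ s, a s * P.eval (r s) + b s * (derivative P).eval (r s) =
      ∑ k ∈ Finset.range K, P.coeff k * (a s * r s ^ k + b s * (k * r s ^ (k - 1))) := by
    intro s
    rw [Polynomial.eval_eq_sum_range' hP, Polynomial.derivative_eval,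
      Polynomial.sum_over_range' P (by simp) K hP, Finset.mul_sum, Finset.mul_sum,
      ← Finset.sum_add_distrib]
    refine Finset.sum_congr rfl fun k _ => by ring
  simp_rw [h1]
  rw [Finset.sum_comm]
  refine Finset.sum_eq_zero fun k hk => ?_
  rw [← Finset.mul_sum, h k (Finset.mem_range.1 hk), mul_zero]

/-- Confluent Vandermonde: the sequences `k ↦ rₛ ^ k` and `k ↦ k rₛ ^ (k - 1)` are linearly
independent for distinct `rₛ`. -/
theorem eq_zero_of_sum_pow_add_sum_mul_pow_eq_zero {S : Type*} [Fintype S] {a b r : S → ℂ}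
    (hr : Function.Injective r) {K : ℕ} (hK : 2 * Fintype.card S ≤ K)
    (h : ∀ k < K, ∑ s, (a s * r s ^ k + b s * (k * r s ^ (k - 1))) = 0) (t : S) :
    a t = 0 ∧ b t = 0 := by
  classical
  -- Q has double zeros at all nodes except t, so only node t survives: testing with (X − r_t) Q
  -- isolates b_t, then testing with Q isolates a_t.
  set Q : ℂ[X] := ∏ s ∈ Finset.univ.erase t, (X - C (r s)) ^ 2 with hQ
  have hcard : 0 < Fintype.card S := Fintype.card_pos_iff.2 ⟨t⟩
  have hQd : Q.natDegree = 2 * (Fintype.card S - 1) := by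
    rw [hQ, natDegree_prod_of_monic _ _ fun s _ => (monic_X_sub_C _).pow 2]
    simp [natDegree_pow, Finset.card_erase_of_mem, mul_comm]
  have hQt : Q.eval (r t) ≠ 0 := by
    rw [hQ, eval_prod, Finset.prod_ne_zero_iff]
    intro s hs
    simpa [sub_eq_zero] using fun hst => (Finset.ne_of_mem_erase hs) (hr hst).symm
  have hQs : ∀ s, s ≠ t → ∃ R, Q = (X - C (r s)) ^ 2 * R := fun s hs =>
    Finset.dvd_prod_of_mem _ (Finset.mem_erase.2 ⟨hs, Finset.mem_univ s⟩)
  have hb : b t = 0 := by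
    have h1 := sum_eval_add_derivative_eq_zero h (P := (X - C (r t)) * Q)
      (lt_of_le_of_lt natDegree_mul_le (by rw [natDegree_X_sub_C, hQd]; omega))
    rw [Finset.sum_eq_single t] at h1
    · simpa [hQt] using h1
    · intro s _ hs
      obtain ⟨R, hR⟩ := hQs s hs
      simp [hR, derivative_pow]
    · simp
  refine ⟨?_, hb⟩
  have h1 := sum_eval_add_derivative_eq_zero h (P := Q) (by rw [hQd]; omega)
  rw [Finset.sum_eq_single t] at h1
  · simpa [hQt, hb] using h1
  · intro s _ hs
    obtain ⟨R, hR⟩ := hQs s hs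
    simp [hR, derivative_pow]
  · simp

end Confluent

/-! ### Derivatives and zeros of trigonometric polynomials. -/

section Trigonometric

open Complex

/-- The `k`-th derivative of the trigonometric function `trigFun l`. -/
noncomputable def trigDer (k l : ℕ) (z : Circle) : ℝ :=
  if Even l then ((I * (l / 2 + 1 : ℕ)) ^ k * (z : ℂ) ^ (l / 2 + 1)).im
  else ((I * (l / 2 + 1 : ℕ)) ^ k * (z : ℂ) ^ (l / 2 + 1)).re

theorem trigDer_zero (l : ℕ) : trigDer 0 l = trigFun l := by
  funext z
  simp [trigDer, trigFun]

theorem sum_range_two_mul {A : Type*} [AddCommMonoid A] (f : ℕ → A) (d : ℕ) :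
    ∑ l ∈ Finset.range (2 * d), f l = ∑ j ∈ Finset.range d, (f (2 * j) + f (2 * j + 1)) := by
  induction d with
  | zero => simp
  | succ d ih => rw [Nat.mul_succ, Finset.sum_range_succ, Finset.sum_range_succ, ih,
      Finset.sum_range_succ, add_assoc]

/-- A real combination of sine and cosine of frequency j + 1 is a conjugate pair of exponentials, on
which differentiation multiplies by ±i(j + 1). This turns derivatives into powers of nodes. -/
theorem mul_trigDer_add_mul_trigDer (k j : ℕ) (z : Circle) (α β : ℝ) :
    ((α * trigDer k (2 * j) z + β * trigDer k (2 * j + 1) z : ℝ) : ℂ) =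
      (((β - α * I) / 2) * (z : ℂ) ^ (j + 1)) * (I * (j + 1 : ℕ)) ^ k +
      (starRingEnd ℂ) (((β - α * I) / 2) * (z : ℂ) ^ (j + 1)) * (-(I * (j + 1 : ℕ))) ^ k := by
  have h1 : 2 * j / 2 = j := by omega
  have h2 : (2 * j + 1) / 2 = j := by omega
  have h3 : ¬ Even (2 * j + 1) := by simp
  have h4 : -(I * ((j + 1 : ℕ) : ℂ)) = (starRingEnd ℂ) (I * ((j + 1 : ℕ) : ℂ)) := by
    rw [map_mul, conj_I, map_natCast, neg_mul]
  rw [h4, ← map_pow, ← map_mul, add_conj]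
  simp only [trigDer, h1, h2, h3, even_two_mul, if_true, if_false]
  set w := (I * ((j + 1 : ℕ) : ℂ)) ^ k * (z : ℂ) ^ (j + 1) with hw
  have h5 : (β - α * I) / 2 * (z : ℂ) ^ (j + 1) * (I * ((j + 1 : ℕ) : ℂ)) ^ k =
    (β - α * I) / 2 * w := by rw [hw]; ring
  rw [h5]
  congr 1
  have h6 : ((β - α * I) / 2 : ℂ) = ⟨β / 2, -α / 2⟩ := by
    apply Complex.ext <;> simp
  rw [h6, show ((⟨β / 2, -α / 2⟩ : ℂ) * w).re = β / 2 * w.re - -α / 2 * w.im from mul_re _ _]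
  ring

/-- The 2d numbers ±i(j + 1) are distinct; each is used as a double node, whence the bound 4d. -/
theorem eq_zero_of_sum_trigDer_eq_zero {d K : ℕ} (hK : 4 * d ≤ K) (z : Circle) (α β : ℕ → ℝ)
    (h : ∀ k < K, ∑ l ∈ Finset.range (2 * d),
      (α l * trigDer k l z + k * (β l * trigDer (k - 1) l z)) = 0) :
    ∀ l < 2 * d, α l = 0 ∧ β l = 0 := by
  let c : (ℕ → ℝ) → ℕ → ℂ := fun γ j => ((γ (2 * j + 1) - γ (2 * j) * I) / 2) * (z : ℂ) ^ (j + 1)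
  let lift : (ℕ → ℝ) → Fin d × Bool → ℂ := fun γ s =>
    if s.2 then c γ s.1 else (starRingEnd ℂ) (c γ s.1)
  let r : Fin d × Bool → ℂ := fun s =>
    if s.2 then I * ((s.1 + 1 : ℕ) : ℂ) else -(I * ((s.1 + 1 : ℕ) : ℂ))
  have hr : Function.Injective r := by
    rintro ⟨i, a⟩ ⟨j, b⟩ hij
    have him := congrArg Complex.im hij
    have hi : (0 : ℝ) ≤ (i : ℕ) := Nat.cast_nonneg _
    have hj : (0 : ℝ) ≤ (j : ℕ) := Nat.cast_nonneg _
    cases a <;> cases b <;> simp [r] at him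
    · rw [Prod.mk.injEq]; exact ⟨Fin.ext (by exact_mod_cast him), rfl⟩
    · linarith
    · linarith
    · rw [Prod.mk.injEq]; exact ⟨Fin.ext (by exact_mod_cast him), rfl⟩
  have hsum : ∀ (γ : ℕ → ℝ) (k : ℕ), ((∑ l ∈ Finset.range (2 * d), γ l * trigDer k l z : ℝ) : ℂ) =
      ∑ s, lift γ s * r s ^ k := by
    intro γ k
    rw [sum_range_two_mul, Fintype.sum_prod_type, ← Finset.sum_range (fun j =>
      ∑ b : Bool, (if b then c γ j else (starRingEnd ℂ) (c γ j)) *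
        (if b then I * ((j + 1 : ℕ) : ℂ) else -(I * ((j + 1 : ℕ) : ℂ))) ^ k), ofReal_sum]
    refine Finset.sum_congr rfl fun j _ => ?_
    rw [mul_trigDer_add_mul_trigDer]
    simp [c]
  have hz := eq_zero_of_sum_pow_add_sum_mul_pow_eq_zero hr (a := lift α) (b := lift β) (K := K)
    (by simp; omega) (by
      intro k hk
      have h1 := congrArg (fun x : ℝ => (x : ℂ)) (h k hk)
      simp only [Finset.sum_add_distrib, ← Finset.mul_sum] at h1
      rw [ofReal_add, ofReal_mul, hsum, hsum, ofReal_zero, ofReal_natCast, Finset.mul_sum,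
        ← Finset.sum_add_distrib] at h1
      rw [← h1]
      exact Finset.sum_congr rfl fun s _ => by ring)
  have hc : ∀ (γ : ℕ → ℝ) (j : ℕ), c γ j = 0 → γ (2 * j) = 0 ∧ γ (2 * j + 1) = 0 := by
    intro γ j h0
    have h1 : ((γ (2 * j + 1) - γ (2 * j) * I) / 2 : ℂ) = 0 :=
      (mul_eq_zero.1 h0).resolve_right (pow_ne_zero _ z.coe_ne_zero)
    have hre := congrArg Complex.re h1
    have him := congrArg Complex.im h1
    simp at hre him
    exact ⟨him, hre⟩
  intro l hl
  have hj : l / 2 < d := by omega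
  have h2 := hz (⟨l / 2, hj⟩, true)
  have hα := hc α (l / 2) (by simpa [lift] using h2.1)
  have hβ := hc β (l / 2) (by simpa [lift] using h2.2)
  rcases Nat.mod_two_eq_zero_or_one l with h0 | h0
  · rw [show 2 * (l / 2) = l by omega] at hα hβ
    exact ⟨hα.1, hβ.1⟩
  · rw [show 2 * (l / 2) + 1 = l by omega] at hα hβ
    exact ⟨hα.2, hβ.2⟩

open Polynomial in
/-- A nonzero trigonometric polynomial without constant term has finitely many zeros. -/
theorem finite_setOf_sum_trigFun_eq_zero {d : ℕ} (α : ℕ → ℝ) {l : ℕ} (hl : l < 2 * d)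
    (hα : α l ≠ 0) :
    {z : Circle | ∑ l ∈ Finset.range (2 * d), α l * trigFun l z = 0}.Finite := by
  let c : ℕ → ℂ := fun j => (α (2 * j + 1) - α (2 * j) * I) / 2
  -- This is z^d times the trigonometric polynomial, with conj z = z⁻¹ on the circle. Its
  -- coefficient at d + l/2 + 1 comes from a single term and contains α l.
  let P : ℂ[X] := ∑ j ∈ Finset.range d,
    (C (c j) * X ^ (d + j + 1) + C ((starRingEnd ℂ) (c j)) * X ^ (d - (j + 1)))
  have hP : P ≠ 0 := by
    intro h0
    have hj : l / 2 < d := by omega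
    have h1 := congrArg (fun p : ℂ[X] => p.coeff (d + l / 2 + 1)) h0
    simp only [P, finsetSum_coeff, coeff_add, coeff_C_mul, coeff_X_pow, coeff_zero] at h1
    rw [Finset.sum_eq_single (l / 2)] at h1
    · have h2 : d + l / 2 + 1 ≠ d - (l / 2 + 1) := by omega
      simp [h2, c] at h1
      have hre := congrArg Complex.re h1
      have him := congrArg Complex.im h1
      simp at hre him
      rcases Nat.mod_two_eq_zero_or_one l with h0 | h0
      · rw [show 2 * (l / 2) = l by omega] at him
        exact hα him
      · rw [show 2 * (l / 2) + 1 = l by omega] at hre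
        exact hα hre
    · intro j hj' hne
      have h2 : d + l / 2 + 1 ≠ d - (j + 1) := by omega
      have h3 : l / 2 ≠ j := hne.symm
      simp [h2, h3]
    · simp [hj]
  refine Set.Finite.of_finite_image (f := fun z : Circle => (z : ℂ)) ?_
    Subtype.val_injective.injOn
  refine (P.roots.toFinset.finite_toSet).subset ?_
  rintro _ ⟨z, hz, rfl⟩
  simp only [Finset.mem_coe, Multiset.mem_toFinset, mem_roots hP, IsRoot.def]
  have h1 : ((∑ l ∈ Finset.range (2 * d), α l * trigFun l z : ℝ) : ℂ) = 0 := by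
    rw [show (∑ l ∈ Finset.range (2 * d), α l * trigFun l z : ℝ) = 0 from hz, ofReal_zero]
  rw [sum_range_two_mul, ofReal_sum] at h1
  simp only [← trigDer_zero, mul_trigDer_add_mul_trigDer, pow_zero, mul_one] at h1
  have h2 : P.eval (z : ℂ) = (z : ℂ) ^ d * 0 := by
    rw [← h1, Finset.mul_sum, eval_finsetSum]
    refine Finset.sum_congr rfl fun j hj => ?_
    have hj' := Finset.mem_range.1 hj
    have h3 : (z : ℂ) ^ d * (starRingEnd ℂ) ((z : ℂ) ^ (j + 1)) = (z : ℂ) ^ (d - (j + 1)) := by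
      nth_rewrite 1 [show d = (d - (j + 1)) + (j + 1) by omega]
      rw [pow_add, mul_assoc, mul_conj, normSq_eq_norm_sq, norm_pow,
        Circle.norm_coe]
      simp
    simp only [eval_add, eval_mul, eval_C, eval_pow, eval_X, map_mul, ← h3, c]
    ring
  simpa using h2

end Trigonometric

/-! ### Chain rules for `mvfderiv`. -/

section Composition

variable {E : Type*} [NormedAddCommGroup E] [NormedSpace ℝ E]
  {H : Type*} [TopologicalSpace H] {I : ModelWithCorners ℝ E H}
  {M : Type*} [TopologicalSpace M] [ChartedSpace H M]
  {E' : Type*} [NormedAddCommGroup E'] [NormedSpace ℝ E']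
  {H' : Type*} [TopologicalSpace H'] {I' : ModelWithCorners ℝ E' H'}
  {M' : Type*} [TopologicalSpace M'] [ChartedSpace H' M']
  {F : Type*} [NormedAddCommGroup F] [NormedSpace ℝ F]
  {F' : Type*} [NormedAddCommGroup F'] [NormedSpace ℝ F']

theorem mvfderiv_comp_hasFDerivAt {g : F → F'} {g' : F →L[ℝ] F'} {f : M → F} {x : M}
    (hg : HasFDerivAt g g' (f x)) (hf : MDifferentiableAt I 𝓘(ℝ, F) f x) (v : TangentSpace I x) :
    mvfderiv I (fun y => g (f y)) x v = g' (mvfderiv I f x v) := by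
  have h := mfderiv_comp (I := I) (I' := 𝓘(ℝ, F)) (I'' := 𝓘(ℝ, F')) x hg.differentiableAt.mdifferentiableAt hf
  rw [mfderiv_eq_fderiv, hg.fderiv] at h
  exact congrArg (fun L : E →L[ℝ] F' => L v) h

theorem mvfderiv_comp_mdifferentiableAt {g : M' → F} {f : M → M'} {x : M}
    (hg : MDifferentiableAt I' 𝓘(ℝ, F) g (f x)) (hf : MDifferentiableAt I I' f x)
    (v : TangentSpace I x) :
    mvfderiv I (fun y => g (f y)) x v = mvfderiv I' g (f x) (mfderiv I I' f x v) :=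
  congrArg (fun L : E →L[ℝ] F => L v) (mfderiv_comp x hg hf)

end Composition

/-! ### The coordinate field on the circle. -/

section CircleCalculus

theorem contMDiff_coe_circle {m : WithTop ℕ∞} :
    ContMDiff (𝓡 1) 𝓘(ℝ, ℂ) m (fun w : Circle => (w : ℂ)) :=
  haveI := finrank_real_complex_fact'
  contMDiff_coe_sphere

theorem contMDiff_mul_circleExp :
    ContMDiff ((𝓡 1).prod 𝓘(ℝ, ℝ)) (𝓡 1) ∞ (fun p : Circle × ℝ => p.1 * Circle.exp p.2) :=
  contMDiff_fst.mul (contMDiff_circleExp.comp contMDiff_snd)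

theorem mvfderiv_coe_circleD (z : Circle) :
    mvfderiv (𝓡 1) (fun w : Circle => (w : ℂ)) z (circleD z) = Complex.I * z := by
  have hd : MDifferentiableAt 𝓘(ℝ, ℝ) (𝓡 1) (fun t : ℝ => z * Circle.exp t) 0 :=
    (contMDiff_const.mul contMDiff_circleExp : ContMDiff 𝓘(ℝ, ℝ) (𝓡 1) 1 _).mdifferentiableAt
      (by simp)
  have h := mvfderiv_comp_mdifferentiableAt (I := 𝓘(ℝ, ℝ)) (I' := 𝓡 1)
    (f := fun t : ℝ => z * Circle.exp t) (x := (0 : ℝ))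
    ((contMDiff_coe_circle (m := 1)).mdifferentiableAt (by simp)) hd (1 : ℝ)
  have h2 : HasDerivAt (fun t : ℝ => ((z * Circle.exp t : Circle) : ℂ))
      (z * Complex.I) 0 := by
    simp only [Circle.coe_mul, Circle.coe_exp]
    have h3 : HasDerivAt (fun t : ℝ => Complex.exp (t * Complex.I)) Complex.I 0 := by
      simpa using ((Complex.ofRealCLM.hasDerivAt (x := (0 : ℝ))).mul_const Complex.I).cexp
    exact h3.const_mul (z : ℂ)
  have h4 : mvfderiv 𝓘(ℝ, ℝ) (fun t : ℝ => ((z * Circle.exp t : Circle) : ℂ)) (0 : ℝ) (1 : ℝ) =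
      z * Complex.I := by
    have h5 := h2.hasFDerivAt.hasMFDerivAt.mfderiv
    exact (congrArg (fun L : ℝ →L[ℝ] ℂ => L 1) h5).trans (by simp)
  -- The chain rule lives at the base point z · exp 0, which is only propositionally z.
  have key : ∀ y : Circle, y = z → ∀ v : EuclideanSpace ℝ (Fin 1),
      mvfderiv (𝓡 1) (fun w : Circle => (w : ℂ)) y v =
      mvfderiv (𝓡 1) (fun w : Circle => (w : ℂ)) z v := by
    rintro _ rfl v; rfl
  have h6 := (h.symm.trans h4).trans (mul_comm _ _)
  exact (key (z * Circle.exp 0) (by rw [Circle.exp_zero, mul_one]) _).symm.trans h6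

/-- The field is the tangent map of (z, t) ↦ z exp(it) applied to the smooth section (0_z, ∂/∂t)
along t = 0. -/
theorem smoothVField_circleD : SmoothVField (I := 𝓡 1) circleD := by
  let F₁ : Circle → TangentBundle (𝓡 1) Circle × TangentBundle 𝓘(ℝ, ℝ) ℝ :=
    fun z => (⟨z, 0⟩, ⟨(0 : ℝ), (1 : ℝ)⟩)
  have S₁ : ContMDiff (𝓡 1) ((𝓡 1).tangent.prod 𝓘(ℝ, ℝ).tangent) ∞ F₁ :=
    (Bundle.contMDiff_zeroSection _ _).prodMk contMDiff_const
  have S₂ := contMDiff_equivTangentBundleProd_symm (n := ∞) (I := 𝓡 1) (M := Circle)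
    (I' := 𝓘(ℝ, ℝ)) (M' := ℝ)
  have S₃ := contMDiff_mul_circleExp.contMDiff_tangentMap (m := ∞) le_rfl
  have S := (S₃.comp S₂).comp S₁
  have e : (fun z => (⟨z, circleD z⟩ : TangentBundle (𝓡 1) Circle)) =
      (tangentMap ((𝓡 1).prod 𝓘(ℝ, ℝ)) (𝓡 1) (fun p : Circle × ℝ => p.1 * Circle.exp p.2) ∘
        (equivTangentBundleProd (𝓡 1) Circle 𝓘(ℝ, ℝ) ℝ).symm) ∘ F₁ := by
    funext z
    have h : mfderiv 𝓘(ℝ, ℝ) (𝓡 1) (fun t : ℝ => z * Circle.exp t) 0 =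
        (mfderiv ((𝓡 1).prod 𝓘(ℝ, ℝ)) (𝓡 1) (fun p : Circle × ℝ => p.1 * Circle.exp p.2)
          (z, (0 : ℝ))).comp
          (mfderiv 𝓘(ℝ, ℝ) ((𝓡 1).prod 𝓘(ℝ, ℝ)) (fun t : ℝ => (z, t)) 0) :=
      mfderiv_comp (I := 𝓘(ℝ, ℝ)) (I' := (𝓡 1).prod 𝓘(ℝ, ℝ)) (0 : ℝ)
        (contMDiff_mul_circleExp.mdifferentiableAt (by simp))
        ((contMDiff_const.prodMk contMDiff_id : ContMDiff 𝓘(ℝ, ℝ) ((𝓡 1).prod 𝓘(ℝ, ℝ)) 1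
          (fun t : ℝ => (z, t))).mdifferentiableAt (by simp))
    rw [mfderiv_prod_right] at h
    have h2 : circleD z = mfderiv ((𝓡 1).prod 𝓘(ℝ, ℝ)) (𝓡 1)
        (fun p : Circle × ℝ => p.1 * Circle.exp p.2) (z, (0 : ℝ))
        ((0 : EuclideanSpace ℝ (Fin 1)), (1 : ℝ)) :=
      congrArg (fun L : ℝ →L[ℝ] EuclideanSpace ℝ (Fin 1) => L 1) h
    have h3 : z = z * Circle.exp 0 := by simp
    exact Bundle.TotalSpace.ext h3 (heq_of_eq h2)
  rw [SmoothVField, e]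
  exact S

theorem mvfderiv_coe_circle_injective (z : Circle) :
    Function.Injective (mvfderiv (𝓡 1) (fun w : Circle => (w : ℂ)) z) :=
  haveI := finrank_real_complex_fact'
  injective_mvfderiv_subtypeVal_sphere z

theorem circleD_ne_zero (z : Circle) : circleD z ≠ 0 := by
  intro h
  have h1 := mvfderiv_coe_circleD z
  rw [h, map_zero] at h1
  simp at h1

theorem exists_smul_circleD (z : Circle) (v : TangentSpace (𝓡 1) z) :
    ∃ c : ℝ, c • circleD z = v := by
  have h : Module.finrank ℝ (EuclideanSpace ℝ (Fin 1)) = 1 := by simp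
  exact (finrank_eq_one_iff_of_nonzero' (circleD z : EuclideanSpace ℝ (Fin 1))
    (circleD_ne_zero z)).1 h v

theorem contMDiff_trigDer (k l : ℕ) : ContMDiff (𝓡 1) 𝓘(ℝ, ℝ) ∞ (trigDer k l) := by
  have h : ContMDiff (𝓡 1) 𝓘(ℝ, ℂ) ∞ (fun z : Circle =>
      (Complex.I * ((l / 2 + 1 : ℕ) : ℂ)) ^ k * (z : ℂ) ^ (l / 2 + 1)) :=
    (contDiff_const.mul (contDiff_id.pow _) : ContDiff ℝ ∞ (fun w : ℂ =>
      (Complex.I * ((l / 2 + 1 : ℕ) : ℂ)) ^ k * w ^ (l / 2 + 1))).contMDiff.comp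
      contMDiff_coe_circle
  by_cases hl : Even l
  · have e : trigDer k l = fun z : Circle => Complex.imCLM
        ((Complex.I * ((l / 2 + 1 : ℕ) : ℂ)) ^ k * (z : ℂ) ^ (l / 2 + 1)) := by
      funext (z : Circle); simp only [trigDer, hl, if_true]; rfl
    rw [e]
    exact (Complex.imCLM.contDiff (n := ∞)).contMDiff.comp h
  · have e : trigDer k l = fun z : Circle => Complex.reCLM
        ((Complex.I * ((l / 2 + 1 : ℕ) : ℂ)) ^ k * (z : ℂ) ^ (l / 2 + 1)) := by
      funext (z : Circle); simp only [trigDer, hl, if_false]; rfl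
    rw [e]
    exact (Complex.reCLM.contDiff (n := ∞)).contMDiff.comp h

theorem mvfderiv_trigDer_circleD (k l : ℕ) (z : Circle) :
    mvfderiv (𝓡 1) (trigDer k l) z (circleD z) = trigDer (k + 1) l z := by
  set m := l / 2 + 1 with hm
  have hp : HasFDerivAt (𝕜 := ℝ) (fun w : ℂ => (Complex.I * (m : ℂ)) ^ k * w ^ m)
      ((ContinuousLinearMap.toSpanSingleton ℂ
        ((Complex.I * (m : ℂ)) ^ k * (m * (z : ℂ) ^ (m - 1)))).restrictScalars ℝ) (z : ℂ) :=
    ((hasDerivAt_pow m (z : ℂ)).const_mul _).hasFDerivAt.restrictScalars ℝ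
  have hc : MDifferentiableAt (𝓡 1) 𝓘(ℝ, ℂ) (fun w : Circle => (w : ℂ)) z :=
    (contMDiff_coe_circle (m := 1)).mdifferentiableAt (by simp)
  have hval : (Complex.I * z) * ((Complex.I * (m : ℂ)) ^ k * (m * (z : ℂ) ^ (m - 1))) =
      (Complex.I * (m : ℂ)) ^ (k + 1) * (z : ℂ) ^ m := by
    obtain ⟨r, hr⟩ : ∃ r, m = r + 1 := ⟨l / 2, hm⟩
    rw [hr, Nat.add_sub_cancel, pow_succ (z : ℂ) r, pow_succ _ k]
    ring
  by_cases hl : Even l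
  · have e : trigDer k l = fun z : Circle => Complex.imCLM
        ((Complex.I * (m : ℂ)) ^ k * (z : ℂ) ^ m) := by
      funext (z : Circle); simp only [trigDer, hl, if_true]; rfl
    rw [e]
    have h := mvfderiv_comp_hasFDerivAt ((Complex.imCLM.hasFDerivAt).comp (z : ℂ) hp) hc (circleD z)
    refine h.trans ?_
    rw [mvfderiv_coe_circleD]
    simp only [trigDer, hl, if_true, ← hm, ← hval]
    rfl
  · have e : trigDer k l = fun z : Circle => Complex.reCLM
        ((Complex.I * (m : ℂ)) ^ k * (z : ℂ) ^ m) := by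
      funext (z : Circle); simp only [trigDer, hl, if_false]; rfl
    rw [e]
    have h := mvfderiv_comp_hasFDerivAt ((Complex.reCLM.hasFDerivAt).comp (z : ℂ) hp) hc (circleD z)
    refine h.trans ?_
    rw [mvfderiv_coe_circleD]
    simp only [trigDer, hl, if_false, ← hm, ← hval]
    rfl

end CircleCalculus

/-! ### Projections of Lie brackets. -/

section RelatedFields

theorem two_le_infty : (2 : WithTop ℕ∞) ≤ ∞ :=
  WithTop.coe_le_coe.2 le_top

variable {E : Type*} [NormedAddCommGroup E] [NormedSpace ℝ E] [CompleteSpace E]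
  {H : Type*} [TopologicalSpace H] {I : ModelWithCorners ℝ E H} [I.Boundaryless]
  {N : Type*} [TopologicalSpace N] [ChartedSpace H N] [IsManifold I ∞ N]
  {E' : Type*} [NormedAddCommGroup E'] [NormedSpace ℝ E'] [CompleteSpace E']
  {H' : Type*} [TopologicalSpace H'] {I' : ModelWithCorners ℝ E' H'} [I'.Boundaryless]
  {M : Type*} [TopologicalSpace M] [ChartedSpace H' M] [IsManifold I' ∞ M]

/-- If the fields `U` and `U'` are mapped to multiples of the coordinate field by a map to the
circle, then so is their bracket. -/
theorem mfderiv_mlieBracket_circle {π : N → Circle} (hπ : ContMDiff I (𝓡 1) ∞ π)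
    {U U' : VField I N} (hU : SmoothVField U) (hU' : SmoothVField U') {g g' : N → ℝ}
    (hg : ContMDiff I 𝓘(ℝ, ℝ) ∞ g) (hg' : ContMDiff I 𝓘(ℝ, ℝ) ∞ g')
    (h : ∀ q, mfderiv I (𝓡 1) π q (U q) = g q • circleD (π q))
    (h' : ∀ q, mfderiv I (𝓡 1) π q (U' q) = g' q • circleD (π q)) (p : N) :
    mfderiv I (𝓡 1) π p (VectorField.mlieBracket I U U' p) =
      (mvfderiv I g' p (U p) - mvfderiv I g p (U' p)) • circleD (π p) := by
  have : IsManifold I 2 N := inferInstance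
  -- The inclusion of the circle in ℂ is an immersion, so the bracket may be tested on f = e^{iπ},
  -- where U f = g · i f. In the commutator the terms with g g' cancel.
  apply mvfderiv_coe_circle_injective
  have hc : ∀ z, MDifferentiableAt (𝓡 1) 𝓘(ℝ, ℂ) (fun w : Circle => (w : ℂ)) z := fun z =>
    (contMDiff_coe_circle (m := 1)).mdifferentiableAt (by simp)
  have hf : ContMDiff I 𝓘(ℝ, ℂ) ∞ (fun q => ((π q : Circle) : ℂ)) := contMDiff_coe_circle.comp hπ
  have key : ∀ (W : VField I N) (c : N → ℝ) (q : N),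
      mfderiv I (𝓡 1) π q (W q) = c q • circleD (π q) →
      mvfderiv I (fun q => ((π q : Circle) : ℂ)) q (W q) = c q • (Complex.I * π q) := by
    intro W c q hW
    rw [mvfderiv_comp_mdifferentiableAt (hc _) (hπ.mdifferentiableAt (by simp)), hW, map_smul,
      mvfderiv_coe_circleD]
  have hI : ∀ (q : N) (u : TangentSpace I q), mvfderiv I (fun q => Complex.I * (π q : ℂ)) q u =
      Complex.I * mvfderiv I (fun q => ((π q : Circle) : ℂ)) q u := fun q u =>
    mvfderiv_comp_hasFDerivAt (g := fun w : ℂ => Complex.I * w)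
      (g' := (ContinuousLinearMap.mul ℝ ℂ Complex.I))
      (ContinuousLinearMap.mul ℝ ℂ Complex.I).hasFDerivAt (hf.mdifferentiableAt (by simp)) u
  have hId : ∀ q, MDifferentiableAt I 𝓘(ℝ, ℂ) (fun q => Complex.I * (π q : ℂ)) q := fun q =>
    ((contDiff_const.mul contDiff_id : ContDiff ℝ ∞ (fun w : ℂ => Complex.I * w)).contMDiff.comp
      hf).mdifferentiableAt (by simp)
  have hprod : ∀ (W : VField I N) (a c : N → ℝ), ContMDiff I 𝓘(ℝ, ℝ) ∞ c →
      mfderiv I (𝓡 1) π p (W p) = a p • circleD (π p) →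
      mvfderiv I (fun q => c q • (Complex.I * (π q : ℂ))) p (W p) =
        c p • (Complex.I * (a p • (Complex.I * (π p : ℂ)))) +
        (mvfderiv I c p (W p)) • (Complex.I * (π p : ℂ)) := by
    intro W a c hcs hW
    rw [mvfderiv_fun_smul (hcs.mdifferentiableAt (by simp)) (hId p)]
    have := hI p (W p)
    rw [key W a p hW] at this
    rw [← this]
    rfl
  have hb := mvfderiv_mlieBracket (f := fun q => ((π q : Circle) : ℂ)) (x := p) (V := U) (W := U')
    ((hf.of_le two_le_infty).contMDiffAt) (hU.mdifferentiableAt (by simp))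
    (hU'.mdifferentiableAt (by simp))
  rw [mvfderiv_comp_mdifferentiableAt (hc _) (hπ.mdifferentiableAt (by simp))] at hb
  rw [hb, funext fun z => key U' g' z (h' z), funext fun z => key U g z (h z),
    hprod U g g' hg' (h p), hprod U' g' g hg (h' p), map_smul, mvfderiv_coe_circleD]
  simp only [Complex.real_smul]
  push_cast
  ring

omit [CompleteSpace E'] [I'.Boundaryless] in
theorem mvfderiv_extChartAt_self (x : M) (v : TangentSpace I' x) :
    mvfderiv I' (extChartAt I' x) x v = v := by
  have : IsManifold I' 1 M := inferInstance
  have h := mfderiv_extChartAt_self (I := I') (x := x)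
  exact congrArg (fun L : E' →L[ℝ] E' => L v) h

omit [CompleteSpace E] [I.Boundaryless] [IsManifold I ∞ N] in
theorem mvfderiv_finset_sum {F : Type*} [NormedAddCommGroup F] [NormedSpace ℝ F] {ι : Type*}
    (s : Finset ι) {f : ι → N → F} {p : N} (hf : ∀ i, MDifferentiableAt I 𝓘(ℝ, F) (f i) p)
    (v : TangentSpace I p) :
    MDifferentiableAt I 𝓘(ℝ, F) (fun q => ∑ i ∈ s, f i q) p ∧
    mvfderiv I (fun q => ∑ i ∈ s, f i q) p v = ∑ i ∈ s, mvfderiv I (f i) p v := by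
  classical
  induction s using Finset.induction_on with
  | empty =>
    simp only [Finset.sum_empty]
    exact ⟨mdifferentiableAt_const, by rw [mvfderiv_const]; rfl⟩
  | insert a s ha ih =>
    simp only [Finset.sum_insert ha]
    refine ⟨(hf a).add ih.1, ?_⟩
    rw [mvfderiv_fun_add (hf a) ih.1, ← ih.2]
    rfl

/-- Bracket of a vertical field with a combination of lifts of vector fields on the base. -/
theorem mfderiv_mlieBracket_of_vertical {π : N → M} (hπ : ContMDiff I I' ∞ π)
    {U U' : VField I N} (hU : SmoothVField U) (hU' : SmoothVField U')
    {ι : Type*} [Fintype ι] {Z : ι → VField I' M} (hZ : ∀ l, SmoothVField (Z l))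
    {f : ι → N → ℝ} (hf : ∀ l, ContMDiff I 𝓘(ℝ, ℝ) ∞ (f l))
    (h : ∀ q, mfderiv I I' π q (U q) = 0)
    (h' : ∀ q, mfderiv I I' π q (U' q) = ∑ l, f l q • Z l (π q)) (p : N) :
    mfderiv I I' π p (VectorField.mlieBracket I U U' p) =
      ∑ l, mvfderiv I (f l) p (U p) • Z l (π p) := by
  have : IsManifold I 2 N := inferInstance
  have : IsManifold I' 2 M := inferInstance
  -- The chart around π p serves as a vector-valued test function: its differential at π p is the
  -- identity, and U annihilates G ∘ π near p.
  set G : M → E' := fun z => extChartAt I' (π p) z with hG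
  have hGs : ContMDiffAt I' 𝓘(ℝ, E') 2 G (π p) :=
    (contMDiffAt_extChartAt (n := ∞)).of_le two_le_infty
  have hGev : ∀ᶠ z in 𝓝 (π p), MDifferentiableAt I' 𝓘(ℝ, E') G z :=
    ((contMDiffAt_iff_contMDiffAt_nhds (by simp)).1 hGs).mono fun z hz =>
      hz.mdifferentiableAt (by simp)
  have hGp : ∀ᶠ q in 𝓝 p, MDifferentiableAt I' 𝓘(ℝ, E') G (π q) :=
    hπ.continuous.continuousAt.eventually hGev
  have hπd : ∀ q, MDifferentiableAt I I' π q := fun q => hπ.mdifferentiableAt (by simp)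
  have hGπ : ContMDiffAt I 𝓘(ℝ, E') 2 (fun q => G (π q)) p :=
    hGs.comp p ((hπ.of_le two_le_infty).contMDiffAt)
  have hb := mvfderiv_mlieBracket (f := fun q => G (π q)) (x := p) (V := U) (W := U')
    hGπ (hU.mdifferentiableAt (by simp)) (hU'.mdifferentiableAt (by simp))
  have e1 : (fun q => mvfderiv I (fun q => G (π q)) q (U q)) =ᶠ[𝓝 p] fun _ => 0 := by
    filter_upwards [hGp] with q hq
    rw [mvfderiv_comp_mdifferentiableAt hq (hπd q), h, map_zero]
  have e2 : (fun q => mvfderiv I (fun q => G (π q)) q (U' q)) =ᶠ[𝓝 p]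
      fun q => ∑ l, f l q • mvfderiv I' G (π q) (Z l (π q)) := by
    filter_upwards [hGp] with q hq
    rw [mvfderiv_comp_mdifferentiableAt hq (hπd q), h', map_sum]
    simp only [map_smul]
  have hc : ∀ l, MDifferentiableAt I' 𝓘(ℝ, E') (fun z => mvfderiv I' G z (Z l z)) (π p) :=
    fun l => (mvfderiv_mvfderiv_apply hGs ((hZ l).mdifferentiableAt (by simp)) 0).1
  have hcπ : ∀ l, MDifferentiableAt I 𝓘(ℝ, E') (fun q => mvfderiv I' G (π q) (Z l (π q))) p :=
    fun l => (hc l).comp p (hπd p)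
  have hfd : ∀ l, MDifferentiableAt I 𝓘(ℝ, ℝ) (f l) p := fun l =>
    (hf l).mdifferentiableAt (by simp)
  have m1 : mvfderiv I (fun q => mvfderiv I (fun q => G (π q)) q (U q)) p (U' p) = 0 := by
    have := congrArg (fun L : E →L[ℝ] E' => L (U' p)) (e1.mfderiv_eq (I := I) (I' := 𝓘(ℝ, E')))
    refine this.trans ?_
    simp only [mfderiv_const]
    rfl
  have m2 : mvfderiv I (fun q => mvfderiv I (fun q => G (π q)) q (U' q)) p (U p) =
      ∑ l, mvfderiv I (f l) p (U p) • mvfderiv I' G (π p) (Z l (π p)) := by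
    have := congrArg (fun L : E →L[ℝ] E' => L (U p)) (e2.mfderiv_eq (I := I) (I' := 𝓘(ℝ, E')))
    refine this.trans ?_
    refine (mvfderiv_finset_sum (I := I) Finset.univ (fun l => (hfd l).smul (hcπ l)) (U p)).2.trans ?_
    refine Finset.sum_congr rfl fun l _ => ?_
    have h1 : mvfderiv I (fun q => mvfderiv I' G (π q) (Z l (π q))) p (U p) = 0 := by
      rw [mvfderiv_comp_mdifferentiableAt (hc l) (hπd p), h, map_zero]
    refine (congrArg (fun L : E →L[ℝ] E' => L (U p)) (mvfderiv_smul (hfd l) (hcπ l))).trans ?_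
    refine Eq.trans (b := f l p • mvfderiv I (fun q => mvfderiv I' G (π q) (Z l (π q))) p (U p) +
      mvfderiv I (f l) p (U p) • mvfderiv I' G (π p) (Z l (π p))) rfl ?_
    rw [h1, smul_zero, zero_add]
  rw [mvfderiv_comp_mdifferentiableAt hGev.self_of_nhds (hπd p), m1, m2, sub_zero] at hb
  rw [mvfderiv_extChartAt_self] at hb
  simp only [mvfderiv_extChartAt_self, hG] at hb
  exact hb

end RelatedFields

/-! ### The product T² × M and the fields A_k. -/

section TorusProduct

variable {n : ℕ} {M : Type*} [TopologicalSpace M] [ChartedSpace (EuclideanSpace ℝ (Fin n)) M]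

theorem contMDiff_projX : ContMDiff (torusProdModel n) (𝓡 1) ∞
    (fun p : (Circle × Circle) × M => p.1.1) :=
  contMDiff_fst.comp contMDiff_fst

theorem contMDiff_projY : ContMDiff (torusProdModel n) (𝓡 1) ∞
    (fun p : (Circle × Circle) × M => p.1.2) :=
  contMDiff_snd.comp contMDiff_fst

theorem contMDiff_projM : ContMDiff (torusProdModel n) (𝓡 n) ∞
    (fun p : (Circle × Circle) × M => p.2) :=
  contMDiff_snd

/-- The type of tangent vectors of `T² × M`, as triples. -/
abbrev TangentTriple (n : ℕ) : Type :=
  (EuclideanSpace ℝ (Fin 1) × EuclideanSpace ℝ (Fin 1)) × EuclideanSpace ℝ (Fin n)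

theorem mfderiv_projX (p : (Circle × Circle) × M) (u : TangentTriple n) :
    mfderiv (torusProdModel n) (𝓡 1) (fun p : (Circle × Circle) × M => p.1.1) p u = u.1.1 := by
  have h := mfderiv_comp (I := torusProdModel n) (I' := (𝓡 1).prod (𝓡 1)) (I'' := 𝓡 1) p
    (g := (Prod.fst : Circle × Circle → Circle)) (f := (Prod.fst : (Circle × Circle) × M → _))
    mdifferentiableAt_fst mdifferentiableAt_fst
  rw [mfderiv_fst, mfderiv_fst] at h
  exact congrArg (fun L : TangentTriple n →L[ℝ] EuclideanSpace ℝ (Fin 1) => L u) h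

theorem mfderiv_projY (p : (Circle × Circle) × M) (u : TangentTriple n) :
    mfderiv (torusProdModel n) (𝓡 1) (fun p : (Circle × Circle) × M => p.1.2) p u = u.1.2 := by
  have h := mfderiv_comp (I := torusProdModel n) (I' := (𝓡 1).prod (𝓡 1)) (I'' := 𝓡 1) p
    (g := (Prod.snd : Circle × Circle → Circle)) (f := (Prod.fst : (Circle × Circle) × M → _))
    mdifferentiableAt_snd mdifferentiableAt_fst
  rw [mfderiv_snd, mfderiv_fst] at h
  exact congrArg (fun L : TangentTriple n →L[ℝ] EuclideanSpace ℝ (Fin 1) => L u) h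

theorem mfderiv_projM (p : (Circle × Circle) × M) (u : TangentTriple n) :
    mfderiv (torusProdModel n) (𝓡 n) (fun p : (Circle × Circle) × M => p.2) p u = u.2 := by
  have h : mfderiv (torusProdModel n) (𝓡 n) (fun p : (Circle × Circle) × M => p.2) p = _ :=
    mfderiv_snd
  exact congrArg (fun L : TangentTriple n →L[ℝ] EuclideanSpace ℝ (Fin n) => L u) h

variable [IsManifold (𝓡 n) ∞ M]

theorem ContMDiff.mvfderiv_apply_field {h : M → ℝ} (hh : ContMDiff (𝓡 n) 𝓘(ℝ, ℝ) ∞ h)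
    {Z : VField (𝓡 n) M} (hZ : SmoothVField Z) :
    ContMDiff (𝓡 n) 𝓘(ℝ, ℝ) ∞ (fun z => mvfderiv (𝓡 n) h z (Z z)) := by
  have h1 := (hh.contMDiff_tangentMap (m := ∞) le_rfl).comp hZ
  exact (contMDiff_snd_tangentBundle_modelSpace ℝ 𝓘(ℝ, ℝ)).comp h1

theorem smoothVField_pair {U : (p : (Circle × Circle) × M) → TangentSpace (𝓡 1) p.1.1}
    {U' : (p : (Circle × Circle) × M) → TangentSpace (𝓡 1) p.1.2}
    {W : (p : (Circle × Circle) × M) → TangentSpace (𝓡 n) p.2}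
    (hU : ContMDiff (torusProdModel n) (𝓡 1).tangent ∞
      (fun p => (⟨p.1.1, U p⟩ : TangentBundle (𝓡 1) Circle)))
    (hU' : ContMDiff (torusProdModel n) (𝓡 1).tangent ∞
      (fun p => (⟨p.1.2, U' p⟩ : TangentBundle (𝓡 1) Circle)))
    (hW : ContMDiff (torusProdModel n) (𝓡 n).tangent ∞
      (fun p => (⟨p.2, W p⟩ : TangentBundle (𝓡 n) M))) :
    SmoothVField (I := torusProdModel n) (M := (Circle × Circle) × M)
      (fun p => (((U p, U' p), W p) : TangentTriple n)) := by
  have S₁ := (contMDiff_equivTangentBundleProd_symm (n := ∞) (I := 𝓡 1) (M := Circle)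
    (I' := 𝓡 1) (M' := Circle)).comp (hU.prodMk hU')
  exact (contMDiff_equivTangentBundleProd_symm (n := ∞) (I := (𝓡 1).prod (𝓡 1))
    (M := Circle × Circle) (I' := 𝓡 n) (M' := M)).comp (S₁.prodMk hW)

omit [TopologicalSpace M] [ChartedSpace (EuclideanSpace ℝ (Fin n)) M] [IsManifold (𝓡 n) ∞ M] in
theorem tangentTriple_eq_sum {ι : Type*} [Fintype ι] (x y : EuclideanSpace ℝ (Fin 1))
    (z : ι → EuclideanSpace ℝ (Fin n)) (a b : ℝ) (c : ι → ℝ) :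
    (((a • x, b • y), ∑ l, c l • z l) : TangentTriple n) =
      a • ((x, 0), 0) + b • ((0, y), 0) + ∑ l, c l • ((0, 0), z l) := by
  refine Prod.ext (Prod.ext ?_ ?_) ?_ <;> simp [Prod.fst_sum, Prod.snd_sum]

/-- A combination of `∂/∂x`, `∂/∂y` and of vector fields on `M` with smooth coefficients. -/
theorem smoothVField_combination {ι : Type*} [Fintype ι] {α g : (Circle × Circle) × M → ℝ}
    {f : ι → (Circle × Circle) × M → ℝ} {Z : ι → VField (𝓡 n) M}
    (hα : ContMDiff (torusProdModel n) 𝓘(ℝ, ℝ) ∞ α)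
    (hg : ContMDiff (torusProdModel n) 𝓘(ℝ, ℝ) ∞ g)
    (hf : ∀ l, ContMDiff (torusProdModel n) 𝓘(ℝ, ℝ) ∞ (f l)) (hZ : ∀ l, SmoothVField (Z l)) :
    SmoothVField (I := torusProdModel n) (M := (Circle × Circle) × M)
      (fun p => (((α p • circleD p.1.1, g p • circleD p.1.2), ∑ l, f l p • Z l p.2) :
        TangentTriple n)) := by
  have h0 : ContMDiff (torusProdModel n) (𝓡 1).tangent ∞
      (fun p : (Circle × Circle) × M => (⟨p.1.1, 0⟩ : TangentBundle (𝓡 1) Circle)) :=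
    (Bundle.contMDiff_zeroSection ℝ _).comp contMDiff_projX
  have h0' : ContMDiff (torusProdModel n) (𝓡 1).tangent ∞
      (fun p : (Circle × Circle) × M => (⟨p.1.2, 0⟩ : TangentBundle (𝓡 1) Circle)) :=
    (Bundle.contMDiff_zeroSection ℝ _).comp contMDiff_projY
  have h0'' : ContMDiff (torusProdModel n) (𝓡 n).tangent ∞
      (fun p : (Circle × Circle) × M => (⟨p.2, 0⟩ : TangentBundle (𝓡 n) M)) :=
    (Bundle.contMDiff_zeroSection ℝ _).comp contMDiff_projM
  have hX := smoothVField_pair (smoothVField_circleD.comp contMDiff_projX) h0' h0''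
  have hY := smoothVField_pair h0 (smoothVField_circleD.comp contMDiff_projY) h0''
  have hZ' := fun l => smoothVField_pair h0 h0' ((hZ l).comp contMDiff_projM)
  have hs := ((hα.smul_section hX).add_section (hg.smul_section hY)).add_section
    (ContMDiff.sum_section (s := Finset.univ) fun l _ => (hf l).smul_section (hZ' l))
  have key : ∀ (p : (Circle × Circle) × M), (((α p • circleD p.1.1, g p • circleD p.1.2),
      ∑ l, f l p • Z l p.2) : TangentTriple n) =
      α p • ((circleD p.1.1, 0), 0) + g p • ((0, circleD p.1.2), 0) +
      ∑ l, f l p • ((0, 0), Z l p.2) := by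
    exact fun p => tangentTriple_eq_sum _ _ _ _ _ _
  unfold SmoothVField
  simp_rw [key]
  exact hs

/-- The iterated bracket `[V, [V, … [V, W] … ]]`, in closed form. -/
noncomputable def iterFieldCoeff (h : M → ℝ) {d : ℕ} (Z : Fin (2 * d) → VField (𝓡 n) M) (k : ℕ)
    (p : (Circle × Circle) × M) : ℝ :=
  -(k * ∑ l : Fin (2 * d), trigDer (k - 1) l p.1.1 * mvfderiv (𝓡 n) h p.2 (Z l p.2))

/-- The zero ∂/∂x-component is written as a multiple of `circleD`, the form in which
`mfderiv_mlieBracket_circle` applies to both circle factors. For k = 0 the factor k in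
`iterFieldCoeff` makes the truncated index k - 1 harmless. -/
noncomputable def iterField (h : M → ℝ) {d : ℕ} (Z : Fin (2 * d) → VField (𝓡 n) M) (k : ℕ) :
    VField (torusProdModel n) ((Circle × Circle) × M) := fun p =>
  ((((0 : ℝ) • circleD p.1.1, iterFieldCoeff h Z k p • circleD p.1.2),
    ∑ l : Fin (2 * d), trigDer k l p.1.1 • Z l p.2) : TangentTriple n)

omit [IsManifold (𝓡 n) ∞ M] in
theorem iterField_zero (h : M → ℝ) {d : ℕ} (Z : Fin (2 * d) → VField (𝓡 n) M) :
    iterField h Z 0 = fieldW Z := by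
  funext p
  simp only [iterField, iterFieldCoeff, fieldW, trigDer_zero, Nat.cast_zero, zero_mul, neg_zero,
    zero_smul]
  rfl

variable {h : M → ℝ} {d : ℕ} {Z : Fin (2 * d) → VField (𝓡 n) M}

theorem smoothVField_fieldV (hh : ContMDiff (𝓡 n) 𝓘(ℝ, ℝ) ∞ h) :
    SmoothVField (fieldV (n := n) h) := by
  have hs := smoothVField_combination (ι := Fin 0) (n := n) (M := M) (α := fun _ => 1)
    (g := fun p => h p.2) (f := fun _ _ => 0) (Z := fun _ _ => 0) contMDiff_const
    (hh.comp contMDiff_projM) (fun l => l.elim0) (fun l => l.elim0)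
  have e : ∀ p : (Circle × Circle) × M, fieldV (n := n) h p =
      ((((1 : ℝ) • circleD p.1.1, h p.2 • circleD p.1.2), ∑ l : Fin 0, (0 : ℝ) • (0 : EuclideanSpace ℝ (Fin n))) :
        TangentTriple n) := by
    intro p
    rw [one_smul, Finset.univ_eq_empty, Finset.sum_empty]
    rfl
  unfold SmoothVField
  simp_rw [e]
  exact hs

theorem contMDiff_iterFieldCoeff (hh : ContMDiff (𝓡 n) 𝓘(ℝ, ℝ) ∞ h)
    (hZ : ∀ l, SmoothVField (Z l)) (k : ℕ) :
    ContMDiff (torusProdModel n) 𝓘(ℝ, ℝ) ∞ (iterFieldCoeff h Z k) := by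
  have h1 : ∀ l ∈ (Finset.univ : Finset (Fin (2 * d))), ContMDiff (torusProdModel n) 𝓘(ℝ, ℝ) ∞
      (fun p : (Circle × Circle) × M =>
        trigDer (k - 1) l p.1.1 * mvfderiv (𝓡 n) h p.2 (Z l p.2)) := fun l _ =>
    ((contMDiff_trigDer (k - 1) l).comp contMDiff_projX).mul
      ((hh.mvfderiv_apply_field (hZ l)).comp contMDiff_projM)
  exact (contDiff_const.mul contDiff_id : ContDiff ℝ ∞ (fun x : ℝ => (k : ℝ) * x)).neg.contMDiff.comp
    (contMDiff_finsetSum h1)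

theorem smoothVField_iterField (hh : ContMDiff (𝓡 n) 𝓘(ℝ, ℝ) ∞ h)
    (hZ : ∀ l, SmoothVField (Z l)) (k : ℕ) : SmoothVField (iterField h Z k) :=
  smoothVField_combination contMDiff_const (contMDiff_iterFieldCoeff hh hZ k)
    (fun l => (contMDiff_trigDer k l).comp contMDiff_projX) hZ

end TorusProduct

/-! ### Brackets of V and the A_k. -/

section Brackets

variable {n : ℕ} {M : Type*} [TopologicalSpace M] [ChartedSpace (EuclideanSpace ℝ (Fin n)) M]
  {h : M → ℝ} {d : ℕ} {Z : Fin (2 * d) → VField (𝓡 n) M}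

theorem ContinuousLinearMap.apply_sum_smul {ι E : Type*} [Fintype ι] [NormedAddCommGroup E]
    [NormedSpace ℝ E] (L : E →L[ℝ] ℝ) (c : ι → ℝ) (v : ι → E) :
    L (∑ l, c l • v l) = ∑ l, c l * L (v l) := by
  simp

theorem tangentTriple_ext (p : (Circle × Circle) × M) {u v : TangentTriple n}
    (hX : mfderiv (torusProdModel n) (𝓡 1) (fun p : (Circle × Circle) × M => p.1.1) p u =
      mfderiv (torusProdModel n) (𝓡 1) (fun p : (Circle × Circle) × M => p.1.1) p v)
    (hY : mfderiv (torusProdModel n) (𝓡 1) (fun p : (Circle × Circle) × M => p.1.2) p u =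
      mfderiv (torusProdModel n) (𝓡 1) (fun p : (Circle × Circle) × M => p.1.2) p v)
    (hM : mfderiv (torusProdModel n) (𝓡 n) (fun p : (Circle × Circle) × M => p.2) p u =
      mfderiv (torusProdModel n) (𝓡 n) (fun p : (Circle × Circle) × M => p.2) p v) : u = v := by
  rw [mfderiv_projX, mfderiv_projX] at hX
  rw [mfderiv_projY, mfderiv_projY] at hY
  rw [mfderiv_projM, mfderiv_projM] at hM
  exact Prod.ext (Prod.ext hX hY) hM

theorem mvfderiv_comp_projX {f : Circle → ℝ} (hf : ContMDiff (𝓡 1) 𝓘(ℝ, ℝ) ∞ f)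
    (p : (Circle × Circle) × M) (u : TangentTriple n) :
    mvfderiv (torusProdModel n) (fun q : (Circle × Circle) × M => f q.1.1) p u =
      mvfderiv (𝓡 1) f p.1.1 u.1.1 :=
  (mvfderiv_comp_mdifferentiableAt (hf.mdifferentiableAt (by simp))
    (contMDiff_projX.mdifferentiableAt (by simp)) u).trans (congrArg _ (mfderiv_projX p u))

theorem mvfderiv_comp_projM {f : M → ℝ} {p : (Circle × Circle) × M}
    (hf : MDifferentiableAt (𝓡 n) 𝓘(ℝ, ℝ) f p.2) (u : TangentTriple n) :
    mvfderiv (torusProdModel n) (fun q : (Circle × Circle) × M => f q.2) p u =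
      mvfderiv (𝓡 n) f p.2 u.2 :=
  (mvfderiv_comp_mdifferentiableAt (f := fun q : (Circle × Circle) × M => q.2) hf
    (contMDiff_projM.mdifferentiableAt (by simp)) u).trans (congrArg _ (mfderiv_projM p u))

theorem mfderiv_projX_fieldV (q : (Circle × Circle) × M) :
    mfderiv (torusProdModel n) (𝓡 1) (fun p : (Circle × Circle) × M => p.1.1) q (fieldV h q) =
      (1 : ℝ) • circleD q.1.1 :=
  (mfderiv_projX q _).trans (one_smul _ _).symm

theorem mfderiv_projY_fieldV (q : (Circle × Circle) × M) :
    mfderiv (torusProdModel n) (𝓡 1) (fun p : (Circle × Circle) × M => p.1.2) q (fieldV h q) =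
      h q.2 • circleD q.1.2 :=
  mfderiv_projY q _

theorem mfderiv_projM_fieldV (q : (Circle × Circle) × M) :
    mfderiv (torusProdModel n) (𝓡 n) (fun p : (Circle × Circle) × M => p.2) q (fieldV h q) = 0 :=
  mfderiv_projM q _

theorem mfderiv_projX_iterField (k : ℕ) (q : (Circle × Circle) × M) :
    mfderiv (torusProdModel n) (𝓡 1) (fun p : (Circle × Circle) × M => p.1.1) q
      (iterField h Z k q) = (0 : ℝ) • circleD q.1.1 :=
  mfderiv_projX q _

theorem mfderiv_projY_iterField (k : ℕ) (q : (Circle × Circle) × M) :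
    mfderiv (torusProdModel n) (𝓡 1) (fun p : (Circle × Circle) × M => p.1.2) q
      (iterField h Z k q) = iterFieldCoeff h Z k q • circleD q.1.2 :=
  mfderiv_projY q _

theorem mfderiv_projM_iterField (k : ℕ) (q : (Circle × Circle) × M) :
    mfderiv (torusProdModel n) (𝓡 n) (fun p : (Circle × Circle) × M => p.2) q
      (iterField h Z k q) = ∑ l : Fin (2 * d), trigDer k l q.1.1 • Z l q.2 :=
  mfderiv_projM q _

/-- The Hessian of `h` at `z`, in the chart around `z`. -/
noncomputable def chartHessian (h : M → ℝ) (z : M) :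
    EuclideanSpace ℝ (Fin n) →L[ℝ] EuclideanSpace ℝ (Fin n) →L[ℝ] ℝ :=
  fderiv ℝ (fderiv ℝ (h ∘ (extChartAt (𝓡 n) z).symm)) (extChartAt (𝓡 n) z z)

theorem chartHessian_symm (hh : ContMDiff (𝓡 n) 𝓘(ℝ, ℝ) ∞ h) (z : M)
    (u v : EuclideanSpace ℝ (Fin n)) : chartHessian h z u v = chartHessian h z v u := by
  have hC := (contMDiffAt_iff.1 (hh.contMDiffAt (x := z))).2
  rw [ModelWithCorners.range_eq_univ, contDiffWithinAt_univ] at hC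
  have hC' : ContDiffAt ℝ ∞ (h ∘ (extChartAt (𝓡 n) z).symm) (extChartAt (𝓡 n) z z) := hC
  exact ((hC'.of_le two_le_infty).isSymmSndFDerivAt (by simp)).eq u v

variable [IsManifold (𝓡 n) ∞ M]

omit [IsManifold (𝓡 n) ∞ M] in
theorem mvfderiv_mul_proj {f : Circle → ℝ} (hf : ContMDiff (𝓡 1) 𝓘(ℝ, ℝ) ∞ f) {c : M → ℝ}
    (hc : ContMDiff (𝓡 n) 𝓘(ℝ, ℝ) ∞ c) (p : (Circle × Circle) × M) (u : TangentTriple n) :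
    MDifferentiableAt (torusProdModel n) 𝓘(ℝ, ℝ)
      (fun q : (Circle × Circle) × M => f q.1.1 * c q.2) p ∧
    mvfderiv (torusProdModel n) (fun q : (Circle × Circle) × M => f q.1.1 * c q.2) p u =
      mvfderiv (𝓡 1) f p.1.1 u.1.1 * c p.2 + f p.1.1 * mvfderiv (𝓡 n) c p.2 u.2 := by
  have hφ : MDifferentiableAt (torusProdModel n) 𝓘(ℝ, ℝ)
      (fun p : (Circle × Circle) × M => f p.1.1) p :=
    (hf.comp contMDiff_projX).mdifferentiableAt (by simp)
  have hψ : MDifferentiableAt (torusProdModel n) 𝓘(ℝ, ℝ)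
      (fun p : (Circle × Circle) × M => c p.2) p :=
    (hc.comp contMDiff_projM).mdifferentiableAt (by simp)
  refine ⟨hφ.mul hψ, ?_⟩
  have e := congrArg (fun L : TangentTriple n →L[ℝ] ℝ => L u) (mvfderiv_mul hφ hψ)
  refine e.trans ?_
  have e1 := mvfderiv_comp_projX hf p u
  have e2 := mvfderiv_comp_projM (p := p) (hc.mdifferentiableAt (by simp)) u
  rw [← e1, ← e2]
  refine Eq.trans (b := f p.1.1 * mvfderiv (torusProdModel n)
      (fun q : (Circle × Circle) × M => c q.2) p u +
      c p.2 * mvfderiv (torusProdModel n)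
      (fun q : (Circle × Circle) × M => f q.1.1) p u) rfl ?_
  rw [add_comm, mul_comm (c p.2)]

theorem mvfderiv_iterFieldCoeff (hh : ContMDiff (𝓡 n) 𝓘(ℝ, ℝ) ∞ h)
    (hZ : ∀ l, SmoothVField (Z l)) (k : ℕ) (p : (Circle × Circle) × M) (u : TangentTriple n) :
    mvfderiv (torusProdModel n) (iterFieldCoeff h Z k) p u =
      -(k * ∑ l : Fin (2 * d),
        (mvfderiv (𝓡 1) (trigDer (k - 1) l) p.1.1 u.1.1 * mvfderiv (𝓡 n) h p.2 (Z l p.2) +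
        trigDer (k - 1) l p.1.1 *
          mvfderiv (𝓡 n) (fun z => mvfderiv (𝓡 n) h z (Z l z)) p.2 u.2)) := by
  have hm := fun l : Fin (2 * d) => mvfderiv_mul_proj (contMDiff_trigDer (k - 1) l)
    (hh.mvfderiv_apply_field (hZ l)) p u
  have h1 := mvfderiv_finset_sum (I := torusProdModel n) Finset.univ (fun l => (hm l).1) u
  have h2 : HasFDerivAt (fun x : ℝ => -(k * x)) (-((k : ℝ) • ContinuousLinearMap.id ℝ ℝ))
      (∑ l : Fin (2 * d), trigDer (k - 1) l p.1.1 * mvfderiv (𝓡 n) h p.2 (Z l p.2)) :=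
    ((hasFDerivAt_id _).const_mul (k : ℝ)).neg
  have h3 := mvfderiv_comp_hasFDerivAt (f := fun q : (Circle × Circle) × M =>
    ∑ l : Fin (2 * d), trigDer (k - 1) l q.1.1 * mvfderiv (𝓡 n) h q.2 (Z l q.2)) h2 h1.1 u
  refine h3.trans ((congrArg (-((k : ℝ) • ContinuousLinearMap.id ℝ ℝ)) h1.2).trans ?_)
  rw [Finset.sum_congr rfl fun l _ => (hm l).2]
  rfl

/-- V differentiates only the φ_l, because it has no M-component. In the ∂/∂y-component V
contributes k copies of −Σ φ_l^{(k)} Z_l h, and −A_k(h) contributes one more. -/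
theorem mlieBracket_fieldV_iterField (hh : ContMDiff (𝓡 n) 𝓘(ℝ, ℝ) ∞ h)
    (hZ : ∀ l, SmoothVField (Z l)) (k : ℕ) :
    VectorField.mlieBracket (torusProdModel n) (fieldV h) (iterField h Z k) =
      iterField h Z (k + 1) := by
  funext p
  have hV := smoothVField_fieldV hh
  have hA := smoothVField_iterField hh hZ k
  refine tangentTriple_ext p ?_ ?_ ?_
  · rw [mfderiv_mlieBracket_circle contMDiff_projX hV hA contMDiff_const contMDiff_const
      mfderiv_projX_fieldV (mfderiv_projX_iterField k), mfderiv_projX_iterField, mvfderiv_const,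
      mvfderiv_const]
    congr 1
    exact sub_self _
  · rw [mfderiv_mlieBracket_circle contMDiff_projY hV hA (hh.comp contMDiff_projM)
      (contMDiff_iterFieldCoeff hh hZ k) mfderiv_projY_fieldV (mfderiv_projY_iterField k),
      mfderiv_projY_iterField]
    congr 1
    have e1 := mvfderiv_iterFieldCoeff hh hZ k p (fieldV h p)
    have e2 := mvfderiv_comp_projM (p := p) (hh.mdifferentiableAt (by simp)) (iterField h Z k p)
    refine (congrArg₂ (· - ·) e1 e2).trans ?_
    have e3 : mvfderiv (𝓡 n) h p.2 (iterField h Z k p).2 =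
        ∑ l : Fin (2 * d), trigDer k l p.1.1 * mvfderiv (𝓡 n) h p.2 (Z l p.2) :=
      ContinuousLinearMap.apply_sum_smul (E := EuclideanSpace ℝ (Fin n)) (mvfderiv (𝓡 n) h p.2)
        (fun l : Fin (2 * d) => trigDer k l p.1.1) (fun l => (Z l p.2 : EuclideanSpace ℝ (Fin n)))
    have e4 : ∀ l : Fin (2 * d), mvfderiv (𝓡 1) (trigDer (k - 1) l) p.1.1 (fieldV (n := n) h p).1.1 =
        trigDer (k - 1 + 1) l p.1.1 := fun l => mvfderiv_trigDer_circleD _ _ _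
    have e5 : ∀ l : Fin (2 * d),
        mvfderiv (𝓡 n) (fun z => mvfderiv (𝓡 n) h z (Z l z)) p.2 (fieldV (n := n) h p).2 = 0 :=
      fun l => map_zero _
    simp only [e3, e4, e5, mul_zero, add_zero, iterFieldCoeff, Nat.add_sub_cancel]
    -- For k = 0 the index k - 1 + 1 is not k, but that term carries the factor 0.
    rcases k with _ | k
    · simp
    · simp only [Nat.add_sub_cancel]
      push_cast
      ring
  · rw [mfderiv_mlieBracket_of_vertical contMDiff_projM hV hA hZ
      (fun l => (contMDiff_trigDer k l).comp contMDiff_projX) mfderiv_projM_fieldV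
      (mfderiv_projM_iterField k), mfderiv_projM_iterField]
    refine Finset.sum_congr rfl fun l _ => ?_
    congr 1
    exact (mvfderiv_comp_projX (contMDiff_trigDer k l) p _).trans (mvfderiv_trigDer_circleD _ _ _)

/-- The Hessian form along the fields `∑ₗ φₗ⁽ʲ⁾ Zₗ` and `∑ₗ φₗ⁽ᵏ⁾ Zₗ`. -/
noncomputable def iterHessian (h : M → ℝ) (Z : Fin (2 * d) → VField (𝓡 n) M) (j k : ℕ)
    (p : (Circle × Circle) × M) : ℝ :=
  chartHessian h p.2 (∑ l : Fin (2 * d), trigDer j l p.1.1 • (Z l p.2 : EuclideanSpace ℝ (Fin n)))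
    (∑ l : Fin (2 * d), trigDer k l p.1.1 • (Z l p.2 : EuclideanSpace ℝ (Fin n)))

/-- Where dh = 0, the terms differentiating the φ_l or the Z_l drop out, and the differential of Z_l
h is the Hessian paired with Z_l. -/
theorem mvfderiv_iterFieldCoeff_of_critical (hh : ContMDiff (𝓡 n) 𝓘(ℝ, ℝ) ∞ h)
    (hZ : ∀ l, SmoothVField (Z l)) (j k : ℕ) {p : (Circle × Circle) × M}
    (hp : mvfderiv (𝓡 n) h p.2 = 0) :
    mvfderiv (torusProdModel n) (iterFieldCoeff h Z k) p (iterField h Z j p) =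
      -(k * iterHessian h Z j (k - 1) p) := by
  have : IsManifold (𝓡 n) 2 M := inferInstance
  refine (mvfderiv_iterFieldCoeff hh hZ k p _).trans ?_
  congr 2
  have e1 : ∀ v : EuclideanSpace ℝ (Fin n), mvfderiv (𝓡 n) h p.2 v = 0 := fun v =>
    congrArg (fun L : EuclideanSpace ℝ (Fin n) →L[ℝ] ℝ => L v) hp
  refine Eq.trans ?_ (ContinuousLinearMap.apply_sum_smul (E := EuclideanSpace ℝ (Fin n)) _ _ _).symm
  refine Finset.sum_congr rfl fun l _ => ?_
  have e2 : ∀ a b c : ℝ, b = 0 → a * b + c = c := fun a b c hb => by rw [hb, mul_zero, zero_add]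
  refine (e2 _ _ _ (e1 _)).trans ?_
  refine congrArg (trigDer (k - 1) l p.1.1 * ·) ?_
  refine (mvfderiv_mvfderiv_apply ((hh.of_le two_le_infty).contMDiffAt)
    ((hZ l).mdifferentiableAt (by simp)) (iterField h Z j p).2).2.trans ?_
  exact (congrArg (_ + ·) (e1 _)).trans (add_zero _)

/-- The M-component w is left unspecified: in the application the covector already vanishes on T_zM.
-/
theorem mlieBracket_iterField_iterField_of_critical (hh : ContMDiff (𝓡 n) 𝓘(ℝ, ℝ) ∞ h)
    (hZ : ∀ l, SmoothVField (Z l)) (j k : ℕ) {p : (Circle × Circle) × M}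
    (hp : mvfderiv (𝓡 n) h p.2 = 0) :
    ∃ w : EuclideanSpace ℝ (Fin n),
      VectorField.mlieBracket (torusProdModel n) (iterField h Z j) (iterField h Z k) p =
        (((0, (j * iterHessian h Z k (j - 1) p - k * iterHessian h Z j (k - 1) p) •
          circleD p.1.2), w) : TangentTriple n) := by
  set b : TangentTriple n :=
    VectorField.mlieBracket (torusProdModel n) (iterField h Z j) (iterField h Z k) p with hb
  set r : TangentTriple n :=
    ((0, (j * iterHessian h Z k (j - 1) p - k * iterHessian h Z j (k - 1) p) • circleD p.1.2), b.2)
    with hr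
  refine ⟨b.2, tangentTriple_ext p (u := b) (v := r) ?_ ?_ ?_⟩
  · rw [hb, mfderiv_mlieBracket_circle contMDiff_projX (smoothVField_iterField hh hZ j)
      (smoothVField_iterField hh hZ k) contMDiff_const contMDiff_const
      (mfderiv_projX_iterField j) (mfderiv_projX_iterField k), mvfderiv_const]
    refine (congrArg (· • circleD p.1.1) (sub_self _)).trans
      ((zero_smul ℝ _).trans (mfderiv_projX p r).symm)
  · rw [hb, mfderiv_mlieBracket_circle contMDiff_projY (smoothVField_iterField hh hZ j)
      (smoothVField_iterField hh hZ k) (contMDiff_iterFieldCoeff hh hZ j)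
      (contMDiff_iterFieldCoeff hh hZ k)
      (mfderiv_projY_iterField j) (mfderiv_projY_iterField k), mfderiv_projY,
      mvfderiv_iterFieldCoeff_of_critical hh hZ _ _ hp,
      mvfderiv_iterFieldCoeff_of_critical hh hZ _ _ hp]
    refine congrArg (· • circleD p.1.2) ?_
    ring
  · rw [mfderiv_projM]
    exact (mfderiv_projM p r).symm

end Brackets

/-! ### Spans of iterated commutators. -/

section CommutatorSpan

variable {E : Type*} [NormedAddCommGroup E] [NormedSpace ℝ E] [CompleteSpace E]
  {H : Type*} [TopologicalSpace H] {I : ModelWithCorners ℝ E H}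
  {M : Type*} [TopologicalSpace M] [ChartedSpace H M] [IsManifold I ∞ M]
  {N : ℕ} {X : Fin N → VField I M}

theorem SmoothVField.mlieBracket {U W : VField I M} (hU : SmoothVField U) (hW : SmoothVField W) :
    SmoothVField (VectorField.mlieBracket I U W) := by
  have : IsManifold I (minSmoothness ℝ 2) M := by
    rw [minSmoothness_of_isRCLikeNormedField]; infer_instance
  have : IsManifold I ((⊤ : ℕ∞) + 1) M := by
    rw [show ((⊤ : ℕ∞) : WithTop ℕ∞) + 1 = ∞ from rfl]; infer_instance
  intro x
  exact ContMDiffAt.mlieBracket_vectorField (m := ⊤) (n := ⊤) (hU x) (hW x)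
    (by rw [minSmoothness_of_isRCLikeNormedField]; exact le_rfl)

omit [CompleteSpace E] [IsManifold I ∞ M] in
variable (X) in
/-- The span of the iterated commutators of lengths at most `r`, as vector fields. -/
noncomputable def commutatorSpan (r : ℕ) : Submodule ℝ (VField I M) :=
  Submodule.span ℝ {Y | ∃ s ≤ r, IsIteratedCommutator X s Y}

omit [CompleteSpace E] [IsManifold I ∞ M] in
theorem commutatorSpan_mono {r r' : ℕ} (h : r ≤ r') : commutatorSpan X r ≤ commutatorSpan X r' :=
  Submodule.span_mono fun _ ⟨s, hs, hY⟩ => ⟨s, hs.trans h, hY⟩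

omit [CompleteSpace E] [IsManifold I ∞ M] in
theorem apply_mem_span_of_mem_commutatorSpan {r : ℕ} {Y : VField I M}
    (hY : Y ∈ commutatorSpan X r) (x : M) :
    Y x ∈ Submodule.span ℝ
      {u : TangentSpace I x | ∃ s ≤ r, ∃ Y : VField I M, IsIteratedCommutator X s Y ∧ Y x = u} := by
  induction hY using Submodule.span_induction with
  | mem Y hY =>
    obtain ⟨s, hs, hY⟩ := hY
    exact Submodule.subset_span ⟨s, hs, Y, hY, rfl⟩
  | zero => exact Submodule.zero_mem _
  | add Y Y' _ _ h h' => exact Submodule.add_mem _ h h'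
  | smul c Y _ h => exact Submodule.smul_mem _ c h

theorem IsIteratedCommutator.smooth (hX : ∀ k, SmoothVField (X k)) {s : ℕ} {Y : VField I M}
    (hY : IsIteratedCommutator X s Y) : SmoothVField Y := by
  induction hY with
  | single k => exact hX k
  | bracket k s Y _ ih => exact (hX k).mlieBracket ih

theorem smooth_of_mem_commutatorSpan (hX : ∀ k, SmoothVField (X k)) {r : ℕ} {Y : VField I M}
    (hY : Y ∈ commutatorSpan X r) : SmoothVField Y := by
  induction hY using Submodule.span_induction with
  | mem Y hY =>
    obtain ⟨s, -, hY⟩ := hY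
    exact hY.smooth hX
  | zero => exact Bundle.contMDiff_zeroSection ℝ _
  | add Y Y' _ _ h h' => exact ContMDiff.add_section h h'
  | smul c Y _ h => exact ContMDiff.const_smul_section h

theorem mlieBracket_mem_commutatorSpan (hX : ∀ k, SmoothVField (X k)) (k : Fin N) {r : ℕ}
    {Y : VField I M} (hY : Y ∈ commutatorSpan X r) :
    VectorField.mlieBracket I (X k) Y ∈ commutatorSpan X (r + 1) := by
  have : IsManifold I 2 M := inferInstance
  induction hY using Submodule.span_induction with
  | mem Y hY =>
    obtain ⟨s, hs, hY⟩ := hY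
    exact Submodule.subset_span ⟨s + 1, by omega, .bracket k s Y hY⟩
  | zero =>
    rw [VectorField.mlieBracket_zero_right]
    exact Submodule.zero_mem _
  | add Y Y' hY hY' h h' =>
    have e : VectorField.mlieBracket I (X k) (Y + Y') =
        VectorField.mlieBracket I (X k) Y + VectorField.mlieBracket I (X k) Y' := by
      funext x
      exact VectorField.mlieBracket_add_right
        ((smooth_of_mem_commutatorSpan hX hY).mdifferentiableAt (by simp))
        ((smooth_of_mem_commutatorSpan hX hY').mdifferentiableAt (by simp))
    rw [e]
    exact Submodule.add_mem _ h h'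
  | smul c Y hY h =>
    have e : VectorField.mlieBracket I (X k) (c • Y) =
        c • VectorField.mlieBracket I (X k) Y := by
      funext x
      exact VectorField.mlieBracket_const_smul_right
        ((smooth_of_mem_commutatorSpan hX hY).mdifferentiableAt (by simp))
    rw [e]
    exact Submodule.smul_mem _ c h

/-- The fields `[X v, [X v, … [X v, X w] … ]]` and their mutual brackets are in the span of the
iterated commutators. -/
theorem iterate_mem_commutatorSpan (hX : ∀ k, SmoothVField (X k)) {v w : Fin N}
    {A : ℕ → VField I M} (h0 : A 0 = X w)
    (hA : ∀ j, VectorField.mlieBracket I (X v) (A j) = A (j + 1)) (j : ℕ) :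
    A j ∈ commutatorSpan X (j + 1) := by
  induction j with
  | zero => rw [h0]; exact Submodule.subset_span ⟨1, le_rfl, .single w⟩
  | succ j ih => rw [← hA]; exact mlieBracket_mem_commutatorSpan hX v ih

/-- Only right-nested commutators are admitted, so [A_j, Y] is rewritten by the Jacobi identity:
[A_{j+1}, Y] = [X_v, [A_j, Y]] − [A_j, [X_v, Y]]. The induction needs Y and r to be arbitrary. -/
theorem mlieBracket_iterate_mem_commutatorSpan (hX : ∀ k, SmoothVField (X k)) {v w : Fin N}
    {A : ℕ → VField I M} (h0 : A 0 = X w)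
    (hA : ∀ j, VectorField.mlieBracket I (X v) (A j) = A (j + 1)) (j : ℕ) :
    ∀ (r : ℕ) (Y : VField I M), Y ∈ commutatorSpan X r →
      VectorField.mlieBracket I (A j) Y ∈ commutatorSpan X (r + j + 1) := by
  have : IsManifold I 2 M := inferInstance
  have : IsManifold I (minSmoothness ℝ 3) M := by
    rw [minSmoothness_of_isRCLikeNormedField]; infer_instance
  induction j with
  | zero =>
    intro r Y hY
    rw [h0]
    exact mlieBracket_mem_commutatorSpan hX w hY
  | succ j ih =>
    intro r Y hY
    have hs : ∀ {W : VField I M}, SmoothVField W → ∀ x, ContMDiffAt I I.tangent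
        (minSmoothness ℝ 2) (fun x => (⟨x, W x⟩ : TangentBundle I M)) x := fun {W} hW x => by
      rw [minSmoothness_of_isRCLikeNormedField]
      exact (hW x).of_le two_le_infty
    have hAs := smooth_of_mem_commutatorSpan hX (iterate_mem_commutatorSpan hX h0 hA j)
    have hYs := smooth_of_mem_commutatorSpan hX hY
    have e : VectorField.mlieBracket I (A (j + 1)) Y =
        VectorField.mlieBracket I (X v) (VectorField.mlieBracket I (A j) Y) -
        VectorField.mlieBracket I (A j) (VectorField.mlieBracket I (X v) Y) := by
      funext x
      have := VectorField.leibniz_identity_mlieBracket_apply (hs (hX v) x) (hs hAs x) (hs hYs x)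
      rw [hA] at this
      exact eq_sub_of_add_eq this.symm
    rw [e]
    refine Submodule.sub_mem _ ?_ ?_
    · exact commutatorSpan_mono (by omega) (mlieBracket_mem_commutatorSpan hX v (ih r Y hY))
    · exact commutatorSpan_mono (by omega)
        (ih (r + 1) _ (mlieBracket_mem_commutatorSpan hX v hY))

end CommutatorSpan

/-! ### Hörmander's condition. -/

section Hormander

theorem eq_zero_of_sum_fin_trigDer_eq_zero {d : ℕ} (z : Circle) (α β : Fin (2 * d) → ℝ)
    (h : ∀ k < 4 * d, ∑ l : Fin (2 * d),
      (α l * trigDer k l z + k * (β l * trigDer (k - 1) l z)) = 0) (l : Fin (2 * d)) :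
    α l = 0 ∧ β l = 0 := by
  let ext : (Fin (2 * d) → ℝ) → ℕ → ℝ := fun γ l => if hl : l < 2 * d then γ ⟨l, hl⟩ else 0
  have he : ∀ (γ : Fin (2 * d) → ℝ) (l : Fin (2 * d)), ext γ l = γ l := fun γ l => by
    simp [ext]
  have h1 := eq_zero_of_sum_trigDer_eq_zero (d := d) le_rfl z (ext α) (ext β) (by
    intro k hk
    rw [Finset.sum_range, ← h k hk]
    exact Finset.sum_congr rfl fun l _ => by rw [he, he]) l l.2
  rwa [he, he] at h1

theorem eq_zero_of_sum_fin_mul_trigDer_eq_zero {d : ℕ} (z : Circle) (α : Fin (2 * d) → ℝ)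
    (h : ∀ k < 4 * d, ∑ l : Fin (2 * d), trigDer k l z * α l = 0) (l : Fin (2 * d)) :
    α l = 0 := by
  refine (eq_zero_of_sum_fin_trigDer_eq_zero z α 0 (fun k hk => ?_) l).1
  refine (Finset.sum_congr rfl fun l _ => ?_).trans (h k hk)
  simp [mul_comm]

variable {n : ℕ} {M : Type*} [TopologicalSpace M] [ChartedSpace (EuclideanSpace ℝ (Fin n)) M]
  {h : M → ℝ} {d : ℕ} {Z : Fin (2 * d) → VField (𝓡 n) M}

theorem eq_zero_of_forall_apply_eq_zero {z : M} (hZ : spanAt Z z = ⊤)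
    {L : EuclideanSpace ℝ (Fin n) →ₗ[ℝ] ℝ} (hL : ∀ l, L (Z l z) = 0) : L = 0 := by
  have h1 : Submodule.span ℝ (range fun l => (Z l z : EuclideanSpace ℝ (Fin n))) = ⊤ := hZ
  refine LinearMap.ext_on_range h1 fun l => ?_
  exact hL l

variable [IsManifold (𝓡 n) ∞ M]

/-- The length 16d + 10 is generous: only V, the A_k with k < 4d, and [A_j, A_k] with j + k ≤ 8d + 1
are used, the latter of length at most j + k + 2. -/
theorem hormanderCondition_fieldV_fieldW (hn : 0 < n) (hh : IsMorseFunction (𝓡 n) h)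
    (hZ : IsSpanningFamily Z) :
    HormanderCondition ![fieldV h, fieldW Z] (16 * d + 10) := by
  intro p
  set X : Fin 2 → VField (torusProdModel n) ((Circle × Circle) × M) := ![fieldV h, fieldW Z] with hX
  have hXs : ∀ k, SmoothVField (X k) := by
    intro k
    fin_cases k
    · exact smoothVField_fieldV hh.smooth
    · have := smoothVField_iterField hh.smooth hZ.smooth 0
      rwa [iterField_zero] at this
  have h0 : iterField h Z 0 = X 1 := iterField_zero h Z
  have hA : ∀ j, VectorField.mlieBracket (torusProdModel n) (X 0) (iterField h Z j) =
    iterField h Z (j + 1) := mlieBracket_fieldV_iterField hh.smooth hZ.smooth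
  -- If the commutators do not span, a nonzero covector kills them all; it is shown to vanish.
  by_contra hne
  obtain ⟨f, hf0, hf⟩ := Submodule.exists_le_ker_of_lt_top _ (lt_top_iff_ne_top.2 hne)
  have hfS : ∀ Y ∈ commutatorSpan X (16 * d + 10), f (Y p) = 0 := fun Y hY =>
    hf (apply_mem_span_of_mem_commutatorSpan hY p)
  let g : TangentTriple n →ₗ[ℝ] ℝ := f
  have hgS : ∀ (Y : VField (torusProdModel n) ((Circle × Circle) × M)) (u : TangentTriple n),
    Y ∈ commutatorSpan X (16 * d + 10) → Y p = u → g u = 0 := by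
    rintro Y _ hY rfl
    exact hfS Y hY
  apply hf0
  set Dx : EuclideanSpace ℝ (Fin 1) := circleD p.1.1 with hDx
  set Dy : EuclideanSpace ℝ (Fin 1) := circleD p.1.2 with hDy
  let ζ : Fin (2 * d) → EuclideanSpace ℝ (Fin n) := fun l => Z l p.2
  let c : Fin (2 * d) → ℝ := fun l => mvfderiv (𝓡 n) h p.2 (Z l p.2)
  have hg : ∀ (a b : ℝ) (w : EuclideanSpace ℝ (Fin n)),
      g ((a • Dx, b • Dy), w) = a * g ((Dx, 0), 0) + b * g ((0, Dy), 0) + g ((0, 0), w) := by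
    intro a b w
    have e : (((a • Dx, b • Dy), w) : TangentTriple n) =
        a • ((Dx, 0), 0) + b • ((0, Dy), 0) + ((0, 0), w) := by
      refine Prod.ext (Prod.ext ?_ ?_) ?_ <;> simp
    rw [e, map_add, map_add, map_smul, map_smul, smul_eq_mul, smul_eq_mul]
  let gM : EuclideanSpace ℝ (Fin n) →ₗ[ℝ] ℝ := g.comp (LinearMap.inr ℝ _ _)
  -- Evaluation on A_k gives exactly a confluent system with unknowns g(Z_l) and −(Z_l h) g(∂/∂y).
  have hlin := eq_zero_of_sum_fin_trigDer_eq_zero p.1.1 (fun l => gM (ζ l))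
    (fun l => -(c l * g ((0, Dy), 0))) (by
      intro k hk
      have h1 := hgS (iterField h Z k) ((((0 : ℝ) • Dx, iterFieldCoeff h Z k p • Dy),
        ∑ l : Fin (2 * d), trigDer k l p.1.1 • ζ l))
        (commutatorSpan_mono (by omega) (iterate_mem_commutatorSpan hXs h0 hA k)) rfl
      rw [hg, zero_mul, zero_add] at h1
      have h2 : g ((0, 0), ∑ l : Fin (2 * d), trigDer k l p.1.1 • ζ l) =
          ∑ l : Fin (2 * d), trigDer k l p.1.1 * gM (ζ l) := by
        have : gM (∑ l : Fin (2 * d), trigDer k l p.1.1 • ζ l) =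
          ∑ l : Fin (2 * d), trigDer k l p.1.1 * gM (ζ l) := by simp
        exact this
      rw [h2, iterFieldCoeff] at h1
      rw [← h1, neg_mul, mul_assoc, Finset.sum_mul, Finset.mul_sum, ← Finset.sum_neg_distrib,
        ← Finset.sum_add_distrib]
      refine Finset.sum_congr rfl fun l _ => ?_
      simp only [c]
      ring)
  have hgM : gM = 0 := eq_zero_of_forall_apply_eq_zero (hZ.span p.2) fun l => (hlin l).1
  have hgM' : ∀ w, g ((0, 0), w) = 0 := fun w => LinearMap.congr_fun hgM w
  have hgy : g ((0, Dy), 0) = 0 := by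
    by_contra hy
    have hc : ∀ l, c l = 0 := fun l => by
      have := (hlin l).2
      simpa [hy] using this
    have hcrit : mvfderiv (𝓡 n) h p.2 = 0 := by
      have h1 := eq_zero_of_forall_apply_eq_zero (hZ.span p.2)
        (L := (mvfderiv (𝓡 n) h p.2 : EuclideanSpace ℝ (Fin n) →L[ℝ] ℝ).toLinearMap) hc
      exact ContinuousLinearMap.coe_injective h1
    have hbr : ∀ j k, j + k ≤ 8 * d + 1 →
        j * iterHessian h Z k (j - 1) p - k * iterHessian h Z j (k - 1) p = 0 := by
      intro j k hjk
      obtain ⟨w, hw⟩ := mlieBracket_iterField_iterField_of_critical hh.smooth hZ.smooth j k hcrit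
      have h1 := hgS _ (((0 : ℝ) • Dx, (j * iterHessian h Z k (j - 1) p -
          k * iterHessian h Z j (k - 1) p) • Dy), w)
        (commutatorSpan_mono (by omega) (mlieBracket_iterate_mem_commutatorSpan hXs h0 hA j _ _
          (iterate_mem_commutatorSpan hXs h0 hA k))) (hw.trans (by rw [zero_smul]; rfl))
      rw [hg, hgM', zero_mul, zero_add, add_zero] at h1
      exact (mul_eq_zero.1 h1).resolve_right hy
    -- The pair (m + 1, 0) gives H(0, m) = 0. The pair (m + 1, i + 1) reduces H(i + 1, m) to H(m +
    -- 1, i), which by symmetry is H(i, m + 1), with the same index sum.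
    have hT : ∀ i m, i + m ≤ 8 * d → iterHessian h Z i m p = 0 := by
      intro i
      induction i with
      | zero =>
        intro m hm
        have h1 := hbr (m + 1) 0 (by omega)
        rw [Nat.cast_zero, zero_mul, sub_zero] at h1
        exact (mul_eq_zero.1 h1).resolve_left (by positivity)
      | succ i ih =>
        intro m hm
        have h1 := hbr (m + 1) (i + 1) (by omega)
        have h2 : iterHessian h Z (m + 1) (i + 1 - 1) p = 0 :=
          (chartHessian_symm hh.smooth _ _ _).trans (ih (m + 1) (by omega))
        rw [h2, mul_zero, sub_zero] at h1
        exact (mul_eq_zero.1 h1).resolve_left (by positivity)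
    -- Independence of the derivatives strips the φ_l from one argument of the Hessian, then from
    -- the other; the two indices below 4d stay within the range 8d of `hT`.
    have hB1 : ∀ m < 4 * d, ∀ l, chartHessian h p.2 (ζ l)
        (∑ l : Fin (2 * d), trigDer m l p.1.1 • ζ l) = 0 := by
      intro m hm l
      refine eq_zero_of_sum_fin_mul_trigDer_eq_zero p.1.1 (fun l => chartHessian h p.2 (ζ l)
        (∑ l : Fin (2 * d), trigDer m l p.1.1 • ζ l)) (fun k hk => ?_) l
      refine Eq.trans (Eq.trans ?_ (ContinuousLinearMap.apply_sum_smul (chartHessian h p.2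
        (∑ l : Fin (2 * d), trigDer m l p.1.1 • ζ l)) (fun l : Fin (2 * d) => trigDer k l p.1.1)
        ζ).symm) ((chartHessian_symm hh.smooth _ _ _).trans (hT k m (by omega)))
      exact Finset.sum_congr rfl fun l _ => congrArg _ (chartHessian_symm hh.smooth _ _ _)
    have hB2 : ∀ l l', chartHessian h p.2 (ζ l) (ζ l') = 0 := by
      intro l l'
      refine eq_zero_of_sum_fin_mul_trigDer_eq_zero p.1.1 (fun l' => chartHessian h p.2 (ζ l)
        (ζ l')) (fun k hk => ?_) l'
      exact (ContinuousLinearMap.apply_sum_smul _ _ _).symm.trans (hB1 k hk l)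
    have hB3 : ∀ l (v : EuclideanSpace ℝ (Fin n)), chartHessian h p.2 (ζ l) v = 0 := fun l v => by
      have h1 := eq_zero_of_forall_apply_eq_zero (hZ.span p.2)
        (L := (chartHessian h p.2 (ζ l)).toLinearMap) (hB2 l)
      exact LinearMap.congr_fun h1 v
    have hB4 : ∀ u v : EuclideanSpace ℝ (Fin n), chartHessian h p.2 u v = 0 := fun u v => by
      have h1 := eq_zero_of_forall_apply_eq_zero (hZ.span p.2)
        (L := (chartHessian h p.2 v).toLinearMap) (fun l =>
          (chartHessian_symm hh.smooth _ _ _).trans (hB3 l v))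
      rw [chartHessian_symm hh.smooth]
      exact LinearMap.congr_fun h1 u
    have hu := hh.nondegenerate p.2 hcrit (EuclideanSpace.single ⟨0, hn⟩ 1) (hB4 _)
    have := congrArg (fun v : EuclideanSpace ℝ (Fin n) => v ⟨0, hn⟩) hu
    simp at this
  have hgx : g ((Dx, 0), 0) = 0 := by
    have h1 := hgS (X 0) (((1 : ℝ) • Dx, h p.2 • Dy), 0)
      (Submodule.subset_span ⟨1, by omega, .single 0⟩) (by rw [one_smul]; rfl)
    rw [hg, hgM', hgy] at h1
    simpa using h1
  have hg0 : g = 0 := by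
    refine LinearMap.ext fun u => ?_
    obtain ⟨⟨u₁, u₂⟩, w⟩ := u
    obtain ⟨a, ha⟩ := exists_smul_circleD p.1.1 u₁
    obtain ⟨b, hb⟩ := exists_smul_circleD p.1.2 u₂
    have h1 := hg a b w
    rw [hgx, hgy, hgM'] at h1
    have e : (((u₁, u₂), w) : TangentTriple n) = ((a • Dx, b • Dy), w) :=
      Prod.ext (Prod.ext ha.symm hb.symm) rfl
    rw [e, h1]
    simp
  exact hg0

end Hormander

/-! ### The zero set of W, and the rank. -/

section ZeroSet

/-- Trivializations are fibrewise linear isomorphisms, so being nonzero is an open condition in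
local coordinates. -/
theorem SmoothVField.isClosed_zeroSet {E : Type*} [NormedAddCommGroup E] [NormedSpace ℝ E]
    {H : Type*} [TopologicalSpace H] {I : ModelWithCorners ℝ E H}
    {M : Type*} [TopologicalSpace M] [ChartedSpace H M] [IsManifold I ∞ M]
    {V : VField I M} (hV : SmoothVField V) : IsClosed {x | V x = 0} := by
  rw [← isOpen_compl_iff, isOpen_iff_mem_nhds]
  intro x hx
  set e := trivializationAt E (TangentSpace I : M → Type _) x with he
  have hc : ContinuousAt (fun y => (e ⟨y, V y⟩).2) x :=
    ((Bundle.contMDiffAt_section x).1 (hV x)).continuousAt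
  have hlin : ∀ y ∈ e.baseSet, ∀ v : TangentSpace I y, (e ⟨y, v⟩).2 = 0 ↔ v = 0 := by
    intro y hy v
    have h1 := congrFun (Bundle.Trivialization.continuousLinearEquivAt_apply ℝ e y hy) v
    exact h1 ▸ (e.continuousLinearEquivAt ℝ y hy).map_eq_zero_iff
  have hxb : x ∈ e.baseSet := FiberBundle.mem_baseSet_trivializationAt' x
  have hne : (e ⟨x, V x⟩).2 ≠ 0 := fun h0 => hx ((hlin x hxb _).1 h0)
  filter_upwards [hc.eventually_ne hne, e.open_baseSet.mem_nhds hxb] with y hy hyb h0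
  exact hy ((hlin y hyb _).2 h0)

variable {n : ℕ} {M : Type*} [TopologicalSpace M] [ChartedSpace (EuclideanSpace ℝ (Fin n)) M]
  {h : M → ℝ} {d : ℕ} {Z : Fin (2 * d) → VField (𝓡 n) M}

theorem fieldW_eq_zero_iff (p : (Circle × Circle) × M) :
    fieldW Z p = 0 ↔
      ∑ l : Fin (2 * d), trigFun l p.1.1 • (Z l p.2 : EuclideanSpace ℝ (Fin n)) = 0 := by
  constructor
  · exact fun h => congrArg (fun u : TangentTriple n => u.2) h
  · exact fun h => (Prod.ext rfl h : (fieldW Z p : TangentTriple n) = 0)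

/-- The Z_l span a nonzero space, so a coordinate functional is nonzero on one of them; applying it
gives a nonzero trigonometric polynomial. -/
theorem finite_setOf_sum_trigFun_smul_eq_zero (hn : 0 < n) {z : M} (hZ : spanAt Z z = ⊤) :
    {x : Circle | ∑ l : Fin (2 * d), trigFun l x • (Z l z : EuclideanSpace ℝ (Fin n)) = 0}.Finite := by
  let L : EuclideanSpace ℝ (Fin n) →L[ℝ] ℝ := EuclideanSpace.proj ⟨0, hn⟩
  have hex : ∃ l, L (Z l z) ≠ 0 := by
    by_contra! hcon
    have h1 := eq_zero_of_forall_apply_eq_zero hZ (L := L.toLinearMap) hcon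
    have h2 := LinearMap.congr_fun h1 (EuclideanSpace.single ⟨0, hn⟩ 1)
    simp [L] at h2
  obtain ⟨l₀, hl₀⟩ := hex
  let α : ℕ → ℝ := fun l => if hl : l < 2 * d then L (Z ⟨l, hl⟩ z) else 0
  have hα : ∀ l : Fin (2 * d), α l = L (Z l z) := fun l => by simp [α]
  refine (finite_setOf_sum_trigFun_eq_zero α l₀.2 (by rw [hα]; exact hl₀)).subset fun x hx => ?_
  have h1 := (ContinuousLinearMap.apply_sum_smul L (fun l : Fin (2 * d) => trigFun l x)
    (fun l => (Z l z : EuclideanSpace ℝ (Fin n)))).symm.trans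
    ((congrArg L (show ∑ l : Fin (2 * d), trigFun l x • (Z l z : EuclideanSpace ℝ (Fin n)) = 0
      from hx)).trans (map_zero L))
  rw [mem_ofPred_eq, Finset.sum_range, ← h1]
  exact Finset.sum_congr rfl fun l _ => by rw [hα, mul_comm]

variable [IsManifold (𝓡 n) ∞ M]

theorem smoothVField_fieldW (hZ : IsSpanningFamily Z) : SmoothVField (fieldW Z) := by
  have := smoothVField_iterField (h := fun _ => 0) contMDiff_const hZ.smooth 0
  rwa [iterField_zero] at this

theorem isNullSet_fieldW_zeroSet (hn : 0 < n) (hZ : IsSpanningFamily Z) :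
    IsNullSet (torusProdModel n) {p : (Circle × Circle) × M | fieldW Z p = 0} := by
  intro c
  set S := {p : (Circle × Circle) × M | fieldW Z p = 0} with hS
  set φ := extChartAt (torusProdModel n) c with hφ
  have hSc : IsClosed S := (smoothVField_fieldW hZ).isClosed_zeroSet
  -- As a difference of open sets the image is measurable, which the Fubini argument requires.
  have hB : φ '' (S ∩ φ.source) = φ.target \ (φ.target ∩ φ.symm ⁻¹' Sᶜ) := by
    rw [inter_comm, φ.image_source_inter_eq']
    ext y
    simp only [mem_inter_iff, mem_preimage, mem_sdiff, mem_compl_iff]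
    tauto
  have hmeas : MeasurableSet (φ '' (S ∩ φ.source)) := by
    rw [hB]
    exact (isOpen_extChartAt_target c).measurableSet.diff
      ((continuousOn_extChartAt_symm c).isOpen_inter_preimage (isOpen_extChartAt_target c)
        hSc.isOpen_compl).measurableSet
  -- Slicing along the x-coordinate: each line parallel to the range of L meets the image in a
  -- finite set.
  let L : EuclideanSpace ℝ (Fin 1) →ₗ[ℝ] TangentTriple n :=
    (LinearMap.inl ℝ _ _).comp (LinearMap.inl ℝ _ _)
  have hae : ∀ᵐ y ∂(Measure.addHaar : Measure (TangentTriple n)), y ∈ (φ '' (S ∩ φ.source))ᶜ := by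
    refine ae_mem_of_ae_add_linearMap_mem L volume _ hmeas.compl fun y => ?_
    rw [ae_iff]
    set T := {x : Circle | ∑ l : Fin (2 * d), trigFun l x •
      (Z l ((extChartAt (𝓡 n) c.2).symm y.2) : EuclideanSpace ℝ (Fin n)) = 0} with hT
    have hTf : T.Finite := finite_setOf_sum_trigFun_smul_eq_zero hn (hZ.span _)
    refine ((hTf.image fun w => extChartAt (𝓡 1) c.1.1 w - y.1.1).subset ?_).measure_zero volume
    intro x hx
    have hx' : y + L x ∈ φ '' (S ∩ φ.source) := not_not.1 hx
    rw [hB] at hx'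
    have hxt : y + L x ∈ φ.target := hx'.1
    have hxS : φ.symm (y + L x) ∈ S := by
      by_contra hcon
      exact hx'.2 ⟨hx'.1, hcon⟩
    rw [hφ, extChartAt_prod, extChartAt_prod] at hxt hxS
    have hxt1 : y.1.1 + x ∈ (extChartAt (𝓡 1) c.1.1).target := hxt.1.1
    have e2 : (y + L x).2 = y.2 := by simp [L]
    refine ⟨(extChartAt (𝓡 1) c.1.1).symm (y.1.1 + x), ?_, ?_⟩
    · have h1 := (fieldW_eq_zero_iff _).1 hxS
      have h2 : ∑ l : Fin (2 * d), trigFun l ((extChartAt (𝓡 1) c.1.1).symm (y.1.1 + x)) •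
        (Z l ((extChartAt (𝓡 n) c.2).symm (y + L x).2) : EuclideanSpace ℝ (Fin n)) = 0 := h1
      rwa [e2] at h2
    · simp only
      rw [(extChartAt (𝓡 1) c.1.1).right_inv hxt1, add_sub_cancel_left]
  rw [ae_iff] at hae
  have e : {y | y ∉ (φ '' (S ∩ φ.source))ᶜ} = φ '' (S ∩ φ.source) := by
    ext
    exact not_not
  rwa [e] at hae

theorem isSingularDistributionOfRank_fieldV_fieldW (hn : 0 < n) (hh : IsMorseFunction (𝓡 n) h)
    (hZ : IsSpanningFamily Z) : IsSingularDistributionOfRank ![fieldV h, fieldW Z] 2 where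
  smooth := by
    intro k
    fin_cases k
    · exact smoothVField_fieldV hh.smooth
    · exact smoothVField_fieldW hZ
  rank := by
    intro c
    refine measure_mono_null (image_mono (inter_subset_inter_left _ fun p hp => ?_))
      (isNullSet_fieldW_zeroSet hn hZ c)
    by_contra hW
    refine hp ?_
    have hW' : fieldW Z p ≠ 0 := hW
    -- V has a nonzero ∂/∂x-component and W has none, so independence only needs W ≠ 0.
    have hli : LinearIndependent ℝ
        ![(fieldV h p : TangentTriple n), (fieldW Z p : TangentTriple n)] := by
      rw [LinearIndependent.pair_iff]
      intro s t hst
      have h1 : s • circleD p.1.1 + t • (0 : TangentSpace (𝓡 1) p.1.1) = 0 :=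
        congrArg (fun u : TangentTriple n => u.1.1) hst
      rw [smul_zero, add_zero] at h1
      have hs : s = 0 := (smul_eq_zero.1 h1).resolve_right (circleD_ne_zero _)
      rw [hs, zero_smul, zero_add] at hst
      exact ⟨hs, (smul_eq_zero.1 hst).resolve_right hW'⟩
    have h2 := finrank_span_eq_card hli
    rw [Fintype.card_fin] at h2
    have e : (fun k : Fin 2 => ((![fieldV h, fieldW Z] k p :) : TangentTriple n)) =
        ![(fieldV h p : TangentTriple n), (fieldW Z p : TangentTriple n)] := by
      funext k
      fin_cases k <;> rfl
    rw [← e] at h2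
    exact h2

end ZeroSet

/-! ### Isotropy. -/

section Isotropic

theorem alternating_apply_smul_smul_same {E : Type*} [AddCommGroup E] [Module ℝ E]
    [TopologicalSpace E] (f : E [⋀^Fin 2]→L[ℝ] ℝ) (a b : ℝ) (w : E) :
    f ![a • w, b • w] = 0 := by
  have e : ![a • w, b • w] = fun i => ![a, b] i • ![w, w] i := by
    funext i
    fin_cases i <;> rfl
  rw [e]
  refine (f.toMultilinearMap.map_smul_univ ![a, b] ![w, w]).trans ?_
  have : f ![w, w] = 0 := f.map_eq_zero_of_eq _ (i := 0) (j := 1) rfl (by decide)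
  exact (congrArg _ this).trans (smul_zero _)

variable {n : ℕ} {M : Type*} [TopologicalSpace M] [ChartedSpace (EuclideanSpace ℝ (Fin n)) M]
  {d : ℕ}

theorem isIsotropic_fieldV_fieldW (σM : TwoForm (𝓡 n) M) (h : M → ℝ)
    (Z : Fin (2 * d) → VField (𝓡 n) M) :
    IsIsotropic (torusForm.directSum σM) ![fieldV h, fieldW Z] := by
  intro p u hu v hv
  set t : EuclideanSpace ℝ (Fin 1) × EuclideanSpace ℝ (Fin 1) :=
    (circleD p.1.1, h p.2 • circleD p.1.2) with ht
  set w : EuclideanSpace ℝ (Fin n) := ∑ l : Fin (2 * d), trigFun l p.1.1 • Z l p.2 with hw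
  have key : ∀ u : TangentTriple n, u ∈ spanAt ![fieldV h, fieldW Z] p →
      ∃ a b : ℝ, u = (a • t, b • w) := by
    intro u hu
    have hu' : u ∈ Submodule.span ℝ (range fun k : Fin 2 =>
      ((![fieldV h, fieldW Z] k p :) : TangentTriple n)) := hu
    clear hu
    induction hu' using Submodule.span_induction with
    | mem x hx =>
      obtain ⟨k, rfl⟩ := hx
      fin_cases k
      · exact ⟨1, 0, Prod.ext (one_smul ℝ t).symm (zero_smul ℝ w).symm⟩
      · exact ⟨0, 1, Prod.ext (zero_smul ℝ t).symm (one_smul ℝ w).symm⟩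
    | zero => exact ⟨0, 0, Prod.ext (zero_smul ℝ t).symm (zero_smul ℝ w).symm⟩
    | add u u' hu hu' ih ih' =>
      obtain ⟨a, b, rfl⟩ := ih
      obtain ⟨a', b', rfl⟩ := ih'
      exact ⟨a + a', b + b', Prod.ext (add_smul a a' t).symm (add_smul b b' w).symm⟩
    | smul c u hu ih =>
      obtain ⟨a, b, rfl⟩ := ih
      exact ⟨c * a, c * b, Prod.ext (mul_smul c a t).symm (mul_smul c b w).symm⟩
  obtain ⟨a, b, rfl⟩ := key u hu
  obtain ⟨a', b', rfl⟩ := key v hv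
  have e1 : torusForm p.1 ![a • t, a' • t] = 0 := alternating_apply_smul_smul_same _ a a' t
  have e2 : σM p.2 ![b • w, b' • w] = 0 := alternating_apply_smul_smul_same _ b b' w
  have e3 : (torusForm.directSum σM) p ![(a • t, b • w), (a' • t, b' • w)] =
      torusForm p.1 ![a • t, a' • t] + σM p.2 ![b • w, b' • w] := by
    refine congrArg₂ (· + ·) (congrArg (torusForm p.1) ?_) (congrArg (σM p.2) ?_) <;>
    · funext i
      fin_cases i <;> rfl
  exact e3.trans (by rw [e1, e2, add_zero])

end Isotropic

/-! ### Global spanning families of vector fields. -/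

section SpanningFamily

/-- A local frame multiplied by a bump function extends by zero and is unchanged near c. -/
theorem exists_smoothVField_spanAt_eq_top_nhds {n : ℕ} {M : Type*} [TopologicalSpace M]
    [ChartedSpace (EuclideanSpace ℝ (Fin n)) M] [IsManifold (𝓡 n) ∞ M] [T2Space M] (c : M) :
    ∃ Z : Fin n → VField (𝓡 n) M, (∀ i, SmoothVField (Z i)) ∧ ∀ᶠ z in 𝓝 c, spanAt Z z = ⊤ := by
  let ρ : SmoothBumpFunction (𝓡 n) c := Classical.choice inferInstance
  set e := trivializationAt (EuclideanSpace ℝ (Fin n)) (TangentSpace (𝓡 n) : M → Type _) c with he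
  let b : Module.Basis (Fin n) ℝ (EuclideanSpace ℝ (Fin n)) := (EuclideanSpace.basisFun (Fin n) ℝ).toBasis
  have hb : e.baseSet = (chartAt (EuclideanSpace ℝ (Fin n)) c).source :=
    TangentBundle.trivializationAt_baseSet c
  refine ⟨fun i => ⇑ρ • e.localFrame b i, fun i => ?_, ?_⟩
  · refine ContMDiffOn.smul_section_of_tsupport (u := e.baseSet) ρ.contMDiff.contMDiffOn
      e.open_baseSet ?_ (e.contMDiffOn_localFrame_baseSet ∞ b i)
    rw [hb]
    exact ρ.tsupport_subset_chartAt_source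
  · have hmem : e.baseSet ∈ 𝓝 c :=
      e.open_baseSet.mem_nhds (FiberBundle.mem_baseSet_trivializationAt' c)
    filter_upwards [ρ.eventuallyEq_one, hmem] with z hz hzb
    have h1 := (e.isLocalFrameOn_localFrame_baseSet (𝓡 n) ∞ b).generating hzb
    rw [eq_top_iff]
    refine h1.trans (Submodule.span_mono ?_)
    rintro _ ⟨i, rfl⟩
    refine ⟨i, ?_⟩
    simp only [Pi.smul_apply', hz, Pi.one_apply, one_smul]

theorem exists_isSpanningFamily (n : ℕ) (M : Type*) [TopologicalSpace M]
    [ChartedSpace (EuclideanSpace ℝ (Fin n)) M] [IsManifold (𝓡 n) ∞ M] [T2Space M]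
    [CompactSpace M] : ∃ (d : ℕ) (Z : Fin (2 * d) → VField (𝓡 n) M), IsSpanningFamily Z := by
  choose Y hY hspan using fun c : M => exists_smoothVField_spanAt_eq_top_nhds (n := n) c
  obtain ⟨t, -, ht⟩ := isCompact_univ.elim_nhds_subcover (fun c : M => {z | spanAt (Y c) z = ⊤})
    fun c _ => hspan c
  -- Each field is listed twice, to make the number of fields even.
  let φ : Bool × (t × Fin n) ≃ Fin (2 * Fintype.card (t × Fin n)) :=
    Fintype.equivFinOfCardEq (by rw [Fintype.card_prod, Fintype.card_bool])
  refine ⟨_, fun l => Y (φ.symm l).2.1 (φ.symm l).2.2, fun l => hY _ _, fun z => ?_⟩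
  obtain ⟨c, hc, hz⟩ := mem_iUnion₂.1 (ht (mem_univ z))
  have hz' : spanAt (Y c) z = ⊤ := hz
  rw [eq_top_iff, ← hz']
  refine Submodule.span_mono ?_
  rintro _ ⟨i, rfl⟩
  exact ⟨φ (true, (⟨c, hc⟩, i)), by simp only [Equiv.symm_apply_apply]⟩

end SpanningFamily

/-! ### Parameters with degenerate critical points form a null set. -/

section CriticalPoints

theorem ContinuousLinearMap.det_eq_zero_of_apply_eq_zero {P : Type*} [NormedAddCommGroup P]
    [NormedSpace ℝ P] [FiniteDimensional ℝ P] {A : P →L[ℝ] P} {v : P} (hv : v ≠ 0)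
    (hA : A v = 0) : A.det = 0 := by
  by_contra hdet
  exact hv ((LinearMap.equivOfDetNeZero (A : P →ₗ[ℝ] P) hdet).map_eq_zero_iff.1 hA)

/-- Since s splits Φ y, the pairs (y, a) with Φ y a = 0 are parametrized by P itself: b encodes y in
p b (through J) and the part of a complementary to s in r b, and a = Ψ b. At a degenerate zero Ψ' is
singular, so the bad a lie in the image of the points where det Ψ' = 0, which is null. -/
theorem addHaar_setOf_degenerate_zero_eq_zero {E F P : Type*} [NormedAddCommGroup E]
    [NormedSpace ℝ E] [NormedAddCommGroup F] [NormedSpace ℝ F] [NormedAddCommGroup P]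
    [NormedSpace ℝ P] [FiniteDimensional ℝ P] [MeasurableSpace P] [BorelSpace P]
    (μ : Measure P) [μ.IsAddHaarMeasure] (J : E ≃L[ℝ] F) {p : P →L[ℝ] F} {s : F →L[ℝ] P}
    (hps : ∀ v, p (s v) = v) {O : Set E} (hO : IsOpen O) {Φ : E → P →L[ℝ] F}
    (hΦ : ∀ y ∈ O, DifferentiableAt ℝ Φ y) (hs : ∀ y ∈ O, ∀ v, Φ y (s v) = v) :
    μ {a | ∃ y ∈ O, Φ y a = 0 ∧ ∃ u, u ≠ 0 ∧ fderiv ℝ Φ y u a = 0} = 0 := by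
  let r : P →L[ℝ] P := ContinuousLinearMap.id ℝ P - s.comp p
  let π : P →L[ℝ] E := (J.symm : F →L[ℝ] E).comp p
  have hr : ∀ b, r b = b - s (p b) := fun b => rfl
  have hrs : ∀ v, r (s v) = 0 := fun v => by rw [hr, hps, sub_self]
  let Ψ : P → P := fun b => r b - s (Φ (π b) (r b))
  let Ψ' : P → P →L[ℝ] P := fun b =>
    r - s.comp ((Φ (π b)).comp r + ((fderiv ℝ Φ (π b)).comp π).flip (r b))
  have hΨ : ∀ b, π b ∈ O → HasFDerivAt Ψ (Ψ' b) b := by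
    intro b hb
    have h1 : HasFDerivAt (fun b => Φ (π b)) ((fderiv ℝ Φ (π b)).comp π) b :=
      (hΦ _ hb).hasFDerivAt.comp b π.hasFDerivAt
    exact r.hasFDerivAt.sub (s.hasFDerivAt.comp b (h1.clm_apply r.hasFDerivAt))
  refine measure_mono_null (t := Ψ '' {b | π b ∈ O ∧ (Ψ' b).det = 0}) ?_
    (addHaar_image_eq_zero_of_det_fderivWithin_eq_zero μ
      (fun b hb => (hΨ b hb.1).hasFDerivWithinAt) fun b hb => hb.2)
  rintro a ⟨y, hy, hya, u, hu, hua⟩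
  -- The parameter of (y, a): the p-coordinate of a is replaced by J y.
  set b := a + s (J y - p a) with hb
  have hpb : p b = J y := by rw [hb, map_add, hps]; abel
  have hπ : π b = y := by
    change J.symm (p b) = y
    rw [hpb, J.symm_apply_apply]
  have hrb : r b = a - s (p a) := by
    rw [hb, map_add, hrs, add_zero, hr]
  have hΦr : Φ y (r b) = - p a := by
    rw [hrb, map_sub, hya, hs y hy, zero_sub]
  -- Φ y (s v) = v does not depend on y, so DΦ(u) vanishes on the range of s; hence it also kills r
  -- b = a − s(p a).
  have hD : ∀ v, fderiv ℝ Φ y u (s v) = 0 := by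
    intro v
    have h1 : HasFDerivAt (fun y => Φ y (s v)) ((fderiv ℝ Φ y).flip (s v)) y := by
      simpa using (hΦ y hy).hasFDerivAt.clm_apply (hasFDerivAt_const (s v) y)
    have h2 : (fun y => Φ y (s v)) =ᶠ[𝓝 y] fun _ => v :=
      Filter.eventually_of_mem (hO.mem_nhds hy) fun z hz => hs z hz v
    have h3 := h1.unique ((hasFDerivAt_const v y).congr_of_eventuallyEq h2)
    exact congrArg (fun A : E →L[ℝ] F => A u) h3
  refine ⟨b, ⟨hπ.symm ▸ hy, ?_⟩, ?_⟩
  · have hsu : s (J u) ≠ 0 := by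
      intro h0
      have h1 := hps (J u)
      rw [h0, map_zero] at h1
      exact hu (J.map_eq_zero_iff.1 h1.symm)
    refine ContinuousLinearMap.det_eq_zero_of_apply_eq_zero hsu ?_
    have hπs : π (s (J u)) = u := by
      change J.symm (p (s (J u))) = u
      rw [hps, J.symm_apply_apply]
    change r (s (J u)) - s (Φ (π b) (r (s (J u))) + fderiv ℝ Φ (π b) (π (s (J u))) (r b)) = 0
    rw [hrs, hπs, hπ, hrb, map_sub, hua, hD, map_zero, sub_zero, add_zero, map_zero, sub_zero]
  · change r b - s (Φ (π b) (r b)) = a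
    rw [hπ, hΦr, hrb, map_neg]
    abel

theorem differentiableAt_sum_comp_flip_compL {ι E P : Type*} [Fintype ι] [NormedAddCommGroup E]
    [NormedSpace ℝ E] [NormedAddCommGroup P] [NormedSpace ℝ P] (p : ι → P →L[ℝ] (E →L[ℝ] ℝ))
    {A : ι → E → E →L[ℝ] E} {y : E} (hA : ∀ j, DifferentiableAt ℝ (A j) y) :
    DifferentiableAt ℝ
      (fun y => ∑ j, ((ContinuousLinearMap.compL ℝ E E ℝ).flip (A j y)).comp (p j)) y := by
  refine DifferentiableAt.fun_sum (𝕜 := ℝ) (E := E) (F := P →L[ℝ] E →L[ℝ] ℝ)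
    (A := fun j y => ((ContinuousLinearMap.compL ℝ E E ℝ).flip (A j y)).comp (p j)) fun j _ => ?_
  have h := HasFDerivAt.comp (F := E →L[ℝ] E) (G := (E →L[ℝ] ℝ) →L[ℝ] E →L[ℝ] ℝ) y
    (ContinuousLinearMap.compL ℝ E E ℝ).flip.hasFDerivAt (hA j).hasFDerivAt
  exact h.differentiableAt.clm_comp (differentiableAt_const _)

theorem addHaar_setOf_degenerate_critical_eq_zero {ι E : Type*} [Fintype ι] [DecidableEq ι]
    [NormedAddCommGroup E] [NormedSpace ℝ E] [FiniteDimensional ℝ E] {O : Set E} (hO : IsOpen O)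
    {κ : ι → E → E} (hκ : ∀ j, ContDiffOn ℝ 2 (κ j) O) {c : ι} (hc : ∀ y ∈ O, κ c y = y) :
    (Measure.addHaar : Measure (ι → E →L[ℝ] ℝ)) {a | ∃ y ∈ O,
      fderiv ℝ (fun y => ∑ j, a j (κ j y)) y = 0 ∧
      ∃ u, u ≠ 0 ∧ fderiv ℝ (fderiv ℝ (fun y => ∑ j, a j (κ j y))) y u = 0} = 0 := by
  have hfin : Module.finrank ℝ E = Module.finrank ℝ (E →L[ℝ] ℝ) := by
    rw [← (LinearMap.toContinuousLinearMap : (E →ₗ[ℝ] ℝ) ≃ₗ[ℝ] E →L[ℝ] ℝ).finrank_eq]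
    exact Subspace.dual_finrank_eq.symm
  -- Φ y sends a to the differential at y of Σ a_j ∘ κ_j. It is split by the c-th inclusion, because
  -- κ_c is the identity on O.
  let Φ : E → (ι → E →L[ℝ] ℝ) →L[ℝ] (E →L[ℝ] ℝ) := fun y =>
    ∑ j, ((ContinuousLinearMap.compL ℝ E E ℝ).flip (fderiv ℝ (κ j) y)).comp
      (ContinuousLinearMap.proj j)
  have hd : ∀ j, ∀ y ∈ O, DifferentiableAt ℝ (κ j) y := fun j y hy =>
    ((hκ j).contDiffAt (hO.mem_nhds hy)).differentiableAt (by norm_num)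
  have hΦ : ∀ y ∈ O, DifferentiableAt ℝ Φ y := by
    intro y hy
    exact differentiableAt_sum_comp_flip_compL _ fun j =>
      (((hκ j).contDiffAt (hO.mem_nhds hy)).fderiv_right (m := 1)
        (by norm_num)).differentiableAt (by norm_num)
  have hΦa : ∀ y ∈ O, ∀ a : ι → E →L[ℝ] ℝ,
      Φ y a = fderiv ℝ (fun y => ∑ j, a j (κ j y)) y := by
    intro y hy a
    have h1 : HasFDerivAt (fun y => ∑ j, a j (κ j y)) (∑ j, (a j).comp (fderiv ℝ (κ j) y)) y :=
      HasFDerivAt.fun_sum fun j _ => (a j).hasFDerivAt.comp y (hd j y hy).hasFDerivAt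
    rw [h1.fderiv, sum_apply]
    rfl
  have hs : ∀ y ∈ O, ∀ v, Φ y (ContinuousLinearMap.single ℝ (fun _ : ι => E →L[ℝ] ℝ) c v) = v := by
    intro y hy v
    have h1 : fderiv ℝ (κ c) y = ContinuousLinearMap.id ℝ E := by
      have h2 : κ c =ᶠ[𝓝 y] id := Filter.eventually_of_mem (hO.mem_nhds hy) hc
      rw [h2.fderiv_eq, fderiv_id]
    rw [sum_apply, Finset.sum_eq_single c]
    · rw [ContinuousLinearMap.comp_apply, ContinuousLinearMap.flip_apply,
        ContinuousLinearMap.compL_apply, h1, ContinuousLinearMap.comp_id]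
      simp
    · intro j _ hj
      simp [hj]
    · exact fun h => absurd (Finset.mem_univ c) h
  refine measure_mono_null ?_ (addHaar_setOf_degenerate_zero_eq_zero Measure.addHaar
    (ContinuousLinearEquiv.ofFinrankEq hfin) (p := ContinuousLinearMap.proj c)
    (s := ContinuousLinearMap.single ℝ (fun _ : ι => E →L[ℝ] ℝ) c) (by simp) hO hΦ hs)
  rintro a ⟨y, hy, h0, u, hu, hu0⟩
  refine ⟨y, hy, (hΦa y hy a).trans h0, u, hu, ?_⟩
  have h1 : HasFDerivAt (fun y => Φ y a) ((fderiv ℝ Φ y).flip a) y := by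
    simpa using (hΦ y hy).hasFDerivAt.clm_apply (hasFDerivAt_const a y)
  have h2 : (fun y => Φ y a) =ᶠ[𝓝 y] fderiv ℝ (fun y => ∑ j, a j (κ j y)) :=
    Filter.eventually_of_mem (hO.mem_nhds hy) fun z hz => hΦa z hz a
  rw [← hu0, ← h2.fderiv_eq, h1.fderiv]
  rfl

end CriticalPoints

/-! ### Change of charts, and existence of Morse functions. -/

section Morse

/-- The term with the second derivative of τ is multiplied by dg, which vanishes at the critical
point. -/
theorem fderiv_fderiv_comp_apply {E F : Type*} [NormedAddCommGroup E] [NormedSpace ℝ E]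
    [NormedAddCommGroup F] [NormedSpace ℝ F] {g : F → ℝ} {τ : E → F} {w : E}
    (hg : ContDiffAt ℝ 2 g (τ w)) (hτ : ContDiffAt ℝ 2 τ w) (h0 : fderiv ℝ g (τ w) = 0) (u v : E) :
    fderiv ℝ (fderiv ℝ (g ∘ τ)) w u v =
      fderiv ℝ (fderiv ℝ g) (τ w) (fderiv ℝ τ w u) (fderiv ℝ τ w v) := by
  have hev : fderiv ℝ (g ∘ τ) =ᶠ[𝓝 w] fun z => (fderiv ℝ g (τ z)).comp (fderiv ℝ τ z) := by
    filter_upwards [hτ.continuousAt.eventually (hg.eventually (by simp)),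
      hτ.eventually (by simp)] with z hgz hτz
    exact fderiv_comp z (hgz.differentiableAt (by norm_num)) (hτz.differentiableAt (by norm_num))
  have h1 : HasFDerivAt (fun z => fderiv ℝ g (τ z))
      ((fderiv ℝ (fderiv ℝ g) (τ w)).comp (fderiv ℝ τ w)) w :=
    ((hg.fderiv_right (m := 1) (by norm_num)).differentiableAt (by norm_num)).hasFDerivAt.comp w
      (hτ.differentiableAt (by norm_num)).hasFDerivAt
  have h2 : HasFDerivAt (fderiv ℝ τ) (fderiv ℝ (fderiv ℝ τ) w) w :=
    ((hτ.fderiv_right (m := 1) (by norm_num)).differentiableAt (by norm_num)).hasFDerivAt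
  have h3 := (h1.clm_comp h2).congr_of_eventuallyEq hev
  rw [h3.fderiv]
  simp [h0]

/-- Nondegeneracy of a critical point is invariant under a change of coordinates. -/
theorem eq_zero_of_fderiv_fderiv_comp_eq_zero {E : Type*} [NormedAddCommGroup E] [NormedSpace ℝ E]
    {g : E → ℝ} {τ σ : E → E} {w : E} (hg : ContDiffAt ℝ 2 g (τ w)) (hτ : ContDiffAt ℝ 2 τ w)
    (hσ : ContDiffAt ℝ 2 σ (τ w)) (hστ : ∀ᶠ z in 𝓝 w, σ (τ z) = z)
    (hτσ : ∀ᶠ z in 𝓝 (τ w), τ (σ z) = z)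
    (hnd : fderiv ℝ g (τ w) = 0 → ∀ u, fderiv ℝ (fderiv ℝ g) (τ w) u = 0 → u = 0)
    (h0 : fderiv ℝ (g ∘ τ) w = 0) {u : E} (hu : ∀ v, fderiv ℝ (fderiv ℝ (g ∘ τ)) w u v = 0) :
    u = 0 := by
  have hw : σ (τ w) = w := hστ.self_of_nhds
  have dτ : HasFDerivAt τ (fderiv ℝ τ w) w := (hτ.differentiableAt (by norm_num)).hasFDerivAt
  have dσ : HasFDerivAt σ (fderiv ℝ σ (τ w)) (τ w) :=
    (hσ.differentiableAt (by norm_num)).hasFDerivAt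
  have e1 : ∀ v, fderiv ℝ σ (τ w) (fderiv ℝ τ w v) = v := by
    have h := (dσ.comp w dτ).unique ((hasFDerivAt_id w).congr_of_eventuallyEq hστ)
    exact fun v => congrArg (fun A : E →L[ℝ] E => A v) h
  have e2 : ∀ v, fderiv ℝ τ w (fderiv ℝ σ (τ w) v) = v := by
    have dτ' : HasFDerivAt τ (fderiv ℝ τ w) (σ (τ w)) := by rwa [hw]
    have h := (dτ'.comp (τ w) dσ).unique ((hasFDerivAt_id (τ w)).congr_of_eventuallyEq hτσ)
    exact fun v => congrArg (fun A : E →L[ℝ] E => A v) h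
  have hg0 : fderiv ℝ g (τ w) = 0 := by
    ext v
    have h := congrArg (fun A : E →L[ℝ] ℝ => A (fderiv ℝ σ (τ w) v))
      ((fderiv_comp w (hg.differentiableAt (by norm_num)) dτ.differentiableAt).symm.trans h0)
    simpa [e2] using h
  have h1 : fderiv ℝ (fderiv ℝ g) (τ w) (fderiv ℝ τ w u) = 0 := by
    ext v
    have h := (fderiv_fderiv_comp_apply hg hτ hg0 u (fderiv ℝ σ (τ w) v)).symm.trans (hu _)
    rwa [e2] at h
  rw [← e1 u, hnd hg0 _ h1, map_zero]

variable {E : Type*} [NormedAddCommGroup E] [NormedSpace ℝ E] {H : Type*} [TopologicalSpace H]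
  {I : ModelWithCorners ℝ E H} {M : Type*} [TopologicalSpace M] [ChartedSpace H M]

theorem eventually_extChartAt_symm_comp {c x z : M} (hzc : z ∈ (extChartAt I c).source)
    (hzx : z ∈ (extChartAt I x).source) :
    ∀ᶠ w in 𝓝 (extChartAt I x z),
      (extChartAt I c).symm (extChartAt I c ((extChartAt I x).symm w)) = (extChartAt I x).symm w := by
  have h1 : ContinuousAt (extChartAt I x).symm (extChartAt I x z) := continuousAt_extChartAt_symm' hzx
  have h2 : (extChartAt I c).source ∈ 𝓝 ((extChartAt I x).symm (extChartAt I x z)) := by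
    rw [(extChartAt I x).left_inv hzx]
    exact extChartAt_source_mem_nhds' hzc
  filter_upwards [h1.preimage_mem_nhds h2] with w hw
  exact (extChartAt I c).left_inv hw

variable [IsManifold I ∞ M]

theorem ContMDiff.contDiffOn_comp_extChartAt_symm {F : Type*} [NormedAddCommGroup F]
    [NormedSpace ℝ F] {f : M → F} (hf : ContMDiff I 𝓘(ℝ, F) ∞ f) (c : M) :
    ContDiffOn ℝ 2 (f ∘ (extChartAt I c).symm) (extChartAt I c).target :=
  (hf.comp_contMDiffOn (contMDiffOn_extChartAt_symm c)).contDiffOn.of_le two_le_infty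

variable [I.Boundaryless]

theorem contDiffAt_extChartAt_comp_extChartAt_symm {c x z : M} (hzc : z ∈ (extChartAt I c).source)
    (hzx : z ∈ (extChartAt I x).source) :
    ContDiffAt ℝ 2 (extChartAt I c ∘ (extChartAt I x).symm) (extChartAt I x z) := by
  have h1 : ContMDiffAt 𝓘(ℝ, E) I ∞ (extChartAt I x).symm (extChartAt I x z) :=
    (contMDiffOn_extChartAt_symm x).contMDiffAt (extChartAt_target_mem_nhds' ((extChartAt I x).map_source hzx))
  have h2 : ContMDiffAt I 𝓘(ℝ, E) ∞ (extChartAt I c) ((extChartAt I x).symm (extChartAt I x z)) := by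
    rw [(extChartAt I x).left_inv hzx]
    exact contMDiffAt_extChartAt' (by rwa [← extChartAt_source I])
  exact (h2.comp _ h1).contDiffAt.of_le two_le_infty

/-- Nondegeneracy may be tested in any one chart containing the point, so finitely many charts
suffice on a compact manifold. -/
theorem isMorseFunction_of_forall_exists_chart {f : M → ℝ} (hf : ContMDiff I 𝓘(ℝ, ℝ) ∞ f)
    (h : ∀ x : M, ∃ c, x ∈ (extChartAt I c).source ∧
      (fderiv ℝ (f ∘ (extChartAt I c).symm) (extChartAt I c x) = 0 →
        ∀ u, fderiv ℝ (fderiv ℝ (f ∘ (extChartAt I c).symm)) (extChartAt I c x) u = 0 → u = 0)) :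
    IsMorseFunction I f where
  smooth := hf
  nondegenerate := by
    intro x hx u hu
    obtain ⟨c, hc, hnd⟩ := h x
    have hxx : x ∈ (extChartAt I x).source := mem_extChartAt_source x
    set g := f ∘ (extChartAt I c).symm with hg
    set τ := extChartAt I c ∘ (extChartAt I x).symm with hτ
    set w := extChartAt I x x with hw
    have hτw : τ w = extChartAt I c x := congrArg (extChartAt I c) (extChartAt_to_inv x)
    have hgτ : f ∘ (extChartAt I x).symm =ᶠ[𝓝 w] g ∘ τ := by
      filter_upwards [eventually_extChartAt_symm_comp hc hxx] with z hz
      exact (congrArg f hz).symm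
    have h0 : fderiv ℝ (f ∘ (extChartAt I x).symm) w = 0 := by
      ext v
      exact (mvfderiv_eq_fderiv_chart (hf.mdifferentiableAt (by simp)) v).symm.trans
        (congrArg (fun A : E →L[ℝ] ℝ => A v) hx)
    refine eq_zero_of_fderiv_fderiv_comp_eq_zero (g := g) (τ := τ)
      (σ := extChartAt I x ∘ (extChartAt I c).symm) (w := w) ?_ ?_ ?_ ?_ ?_ ?_ ?_ (u := u) ?_
    · rw [hτw]
      exact (hf.contDiffOn_comp_extChartAt_symm c).contDiffAt (extChartAt_target_mem_nhds' ((extChartAt I c).map_source hc))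
    · exact contDiffAt_extChartAt_comp_extChartAt_symm hc hxx
    · rw [hτw]
      exact contDiffAt_extChartAt_comp_extChartAt_symm hxx hc
    · filter_upwards [eventually_extChartAt_symm_comp hc hxx, extChartAt_target_mem_nhds x] with z hz hzt
      change extChartAt I x ((extChartAt I c).symm (extChartAt I c ((extChartAt I x).symm z))) = z
      rw [hz, (extChartAt I x).right_inv hzt]
    · rw [hτw]
      filter_upwards [eventually_extChartAt_symm_comp hxx hc, extChartAt_target_mem_nhds' ((extChartAt I c).map_source hc)]
        with z hz hzt
      change extChartAt I c ((extChartAt I x).symm (extChartAt I x ((extChartAt I c).symm z))) = z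
      rw [hz, (extChartAt I c).right_inv hzt]
    · rwa [hτw]
    · rw [← hgτ.fderiv_eq, h0]
    · intro v
      rw [← hgτ.fderiv.fderiv_eq]
      exact hu v

variable [FiniteDimensional ℝ E] [T2Space M] [CompactSpace M]

variable (I M) in
-- Take Σ a_j(ρ_j · chart_j) over a finite cover by regions where some ρ_c = 1. There the c-th term
-- is a linear function of the coordinates, so the null-set result applies to each region; a
-- parameter outside the finite union works.
theorem exists_isMorseFunction : ∃ h : M → ℝ, IsMorseFunction I h := by
  classical
  let ρ : ∀ c : M, SmoothBumpFunction I c := fun c => Classical.choice inferInstance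
  obtain ⟨t, -, ht⟩ := isCompact_univ.elim_nhds_subcover
    (fun c : M => {x | ρ c =ᶠ[𝓝 x] 1} ∩ (extChartAt I c).source)
    fun c _ => Filter.inter_mem (ρ c).eventuallyEq_one.eventually_nhds (extChartAt_source_mem_nhds c)
  let k : t → M → E := fun c x => ρ c x • extChartAt I (c : M) x
  have hk : ∀ c, ContMDiff I 𝓘(ℝ, E) ∞ (k c) := fun c =>
    (ρ c).contMDiff_smul contMDiffOn_extChartAt
  let κ : t → t → E → E := fun c j => k j ∘ (extChartAt I (c : M)).symm
  let O : t → Set E := fun c => (extChartAt I (c : M)).target ∩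
    (extChartAt I (c : M)).symm ⁻¹' {x | ρ c =ᶠ[𝓝 x] 1}
  have hO : ∀ c, IsOpen (O c) := fun c =>
    (continuousOn_extChartAt_symm (c : M)).isOpen_inter_preimage (isOpen_extChartAt_target (c : M))
      isOpen_setOfPred_eventually_nhds
  have hnull : ∀ c : t, _ := fun c => addHaar_setOf_degenerate_critical_eq_zero (hO c) (κ := κ c)
    (c := c) (fun j => ((hk j).contDiffOn_comp_extChartAt_symm (c : M)).mono inter_subset_left) (by
      intro y hy
      have h1 : ρ c ((extChartAt I (c : M)).symm y) = 1 := Filter.EventuallyEq.eq_of_nhds (show ρ c =ᶠ[𝓝 _] 1 from hy.2)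
      change ρ c ((extChartAt I (c : M)).symm y) •
        extChartAt I (c : M) ((extChartAt I (c : M)).symm y) = y
      rw [h1, one_smul, (extChartAt I (c : M)).right_inv hy.1])
  obtain ⟨a, ha⟩ := (measure_eq_zero_iff_ae_notMem.1 (measure_iUnion_null hnull)).exists
  refine ⟨fun x => ∑ j, a j (k j x), isMorseFunction_of_forall_exists_chart ?_ fun x => ?_⟩
  · exact ContMDiff.sum fun j _ => (a j).contMDiff.comp (hk j)
  · obtain ⟨c, hc, hx⟩ := mem_iUnion₂.1 (ht (mem_univ x))
    refine ⟨c, hx.2, fun h0 u hu => ?_⟩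
    by_contra hu0
    refine ha (mem_iUnion.2 ⟨⟨c, hc⟩, extChartAt I c x, ⟨(extChartAt I c).map_source hx.2, ?_⟩, h0, u,
      hu0, hu⟩)
    rw [mem_preimage, (extChartAt I c).left_inv hx.2]
    exact hx.1

end Morse

/-! ### The main theorem. -/

theorem mainTheorem3 {n : ℕ} (hn : 0 < n)
    {M : Type*} [TopologicalSpace M] [ChartedSpace (EuclideanSpace ℝ (Fin n)) M]
    [IsManifold (𝓡 n) ∞ M] [CompactSpace M] [T2Space M]
    (σM : TwoForm (𝓡 n) M) (hσM : IsSymplecticForm σM) :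
    (∃ (N : ℕ) (X : Fin N → VField (torusProdModel n) ((Circle × Circle) × M)),
      IsSingularDistribution X ∧ IsIsotropic (torusForm.directSum σM) X ∧ SatisfiesHormander X) ∧
    (∃ h : M → ℝ, IsMorseFunction (𝓡 n) h) ∧
    (∃ (d : ℕ) (Z : Fin (2 * d) → VField (𝓡 n) M), IsSpanningFamily Z) ∧
    (∀ h : M → ℝ, IsMorseFunction (𝓡 n) h →
      ∀ (d : ℕ) (Z : Fin (2 * d) → VField (𝓡 n) M), IsSpanningFamily Z →
        IsSingularDistributionOfRank ![fieldV h, fieldW Z] 2 ∧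
        IsIsotropic (torusForm.directSum σM) ![fieldV h, fieldW Z] ∧
        SatisfiesHormander ![fieldV h, fieldW Z] ∧
        IsClosed {p : (Circle × Circle) × M | fieldW Z p = 0} ∧
        IsNullSet (torusProdModel n) {p : (Circle × Circle) × M | fieldW Z p = 0}) := by
  have hmain : ∀ h : M → ℝ, IsMorseFunction (𝓡 n) h →
      ∀ (d : ℕ) (Z : Fin (2 * d) → VField (𝓡 n) M), IsSpanningFamily Z →
        IsSingularDistributionOfRank ![fieldV h, fieldW Z] 2 ∧
        IsIsotropic (torusForm.directSum σM) ![fieldV h, fieldW Z] ∧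
        SatisfiesHormander ![fieldV h, fieldW Z] ∧
        IsClosed {p : (Circle × Circle) × M | fieldW Z p = 0} ∧
        IsNullSet (torusProdModel n) {p : (Circle × Circle) × M | fieldW Z p = 0} :=
    fun h hh d Z hZ => ⟨isSingularDistributionOfRank_fieldV_fieldW hn hh hZ,
      isIsotropic_fieldV_fieldW σM h Z, ⟨_, hormanderCondition_fieldV_fieldW hn hh hZ⟩,
      (smoothVField_fieldW hZ).isClosed_zeroSet, isNullSet_fieldW_zeroSet hn hZ⟩
  obtain ⟨h, hh⟩ := exists_isMorseFunction (𝓡 n) M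
  obtain ⟨d, Z, hZ⟩ := exists_isSpanningFamily n M
  obtain ⟨h1, h2, h3, -⟩ := hmain h hh d Z hZ
  exact ⟨⟨2, _, ⟨2, h1⟩, h2, h3⟩, ⟨h, hh⟩, ⟨d, Z, hZ⟩, hmain⟩
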